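/- Let $k\ge 2$ and $n\ge 1$ be integers and let $A=\{0<1<\cdots<k-1\}$; words over $A$ are ordered lexicographically. A nonempty word is primitive if it is not a power of some other word; a necklace is the conjugacy class (the class under cyclic rotation) of a primitive word, its length is the common length of its words, and its Lyndon word is its lexicographically first word. For a finite multiset $M$ of necklaces over $A$ let $l$ be the least common multiple of the lengths of its members, and sort lexicographically the collection (with multiplicity) of the words $u^{l/|u|}$, where $u$ runs over the words of the necklaces in $M$. The Burrows–Wheeler transform $BW(M)$ is the word formed by the last letters of these words of length $l$, read in that order (and $BW(\emptyset)$ is the empty word). A de Bruijn word of span $n$ is a word $w$ over $A$ of length $k^n$ such that every word of length $n$ over $A$ appears exactly once as a cyclic factor of $w$, i.e. can be read cyclically in $w$ from exactly one starting position. Let $\alpha = 0\,1\cdots(k-1)$. Then there is exactly one finite multiset $M$ of necklaces over $A$ with $BW(M)=\alpha^{k^{n-1}}$, denoted $BW^{-1}(\alpha^{k^{n-1}})$, and the concatenation of the Lyndon words of the necklaces of $M$, taken in ascending lexicographic order, is the lexicographically first de Bruijn word of span $n$ over $A$. -/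

import Mathlib

namespace BWT

section Words

variable {A : Type*}

/-- The power `u ^ t` of a word `u` in the free monoid of words. -/
def wpow (u : List A) (t : ℕ) : List A := (List.replicate t u).flatten

/-- A nonempty word is primitive if it is not a power of some other word. -/
def IsPrimitive (w : List A) : Prop :=
  w ≠ [] ∧ ∀ (u : List A) (t : ℕ), wpow u t = w → u = w

variable (A) in
/-- A necklace: the conjugacy class (class under cyclic rotation) of a primitive word. -/
@[ext]
structure Necklace where
  /-- The conjugacy class. -/
  cycle : Cycle A
  /-- It is the class of a primitive word. -/
  exists_primitive : ∃ w : List A, IsPrimitive w ∧ (w : Cycle A) = cycle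

/-- The length of a necklace: the common length of its words. -/
def Necklace.length (N : Necklace A) : ℕ := N.cycle.length

/-- The words of a necklace, each of them listed once (see `Necklace.mem_words` and
`Necklace.nodup_words`). -/
def Necklace.words (N : Necklace A) : Multiset (List A) := N.cycle.lists

theorem Necklace.mem_words (N : Necklace A) (u : List A) :
    u ∈ N.words ↔ (u : Cycle A) = N.cycle :=
  Cycle.mem_lists_iff_coe_eq

theorem eq_wpow_of_append_comm (u : List A) (t : ℕ) (x : List A)
    (hx : x.length = t * u.length) (h : x ++ u = u ++ x) : x = wpow u t := by
  induction t generalizing x with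
  | zero => simpa [wpow] using hx
  | succ t ih =>
    have hp : u <+: x := by
      refine List.prefix_of_prefix_length_le (l₃ := x ++ u) ?_ (List.prefix_append _ _) ?_
      · rw [h]; exact List.prefix_append _ _
      · rw [hx]; nlinarith [Nat.zero_le (t * u.length)]
    obtain ⟨y, rfl⟩ := hp
    have hy : y = wpow u t := by
      refine ih y ?_ ?_
      · rw [List.length_append] at hx; linarith
      · simpa using h
    rw [hy]
    simp [wpow, List.replicate_succ]

theorem IsPrimitive.rotate_ne {w : List A} (hw : IsPrimitive w) {d : ℕ} (hd : 0 < d)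
    (hdw : d < w.length) : w.rotate d ≠ w := by
  intro h
  have hit : ∀ m : ℕ, (fun l : List A => l.rotate 1)^[m] w = w.rotate m := by
    intro m
    induction m with
    | zero => simp
    | succ m ih => rw [Function.iterate_succ_apply', ih, List.rotate_rotate]
  have h1 : Function.IsPeriodicPt (fun l : List A => l.rotate 1) d w := by
    rw [Function.IsPeriodicPt, Function.IsFixedPt, hit, h]
  have h2 : Function.IsPeriodicPt (fun l : List A => l.rotate 1) w.length w := by
    rw [Function.IsPeriodicPt, Function.IsFixedPt, hit, List.rotate_length]
  have h3 := h1.gcd h2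
  rw [Function.IsPeriodicPt, Function.IsFixedPt, hit] at h3
  set g := d.gcd w.length with hg
  have hgd : g ≤ d := Nat.gcd_le_left _ hd
  obtain ⟨t, ht⟩ : g ∣ w.length := Nat.gcd_dvd_right _ _
  have hlen : (w.take g).length = g := by
    rw [List.length_take]; omega
  have h4 : w.drop g ++ w.take g = w := by
    rw [← List.rotate_eq_drop_append_take (by omega), h3]
  have h5 : w = wpow (w.take g) t := by
    refine eq_wpow_of_append_comm _ _ _ (by rw [hlen, ht, mul_comm]) ?_
    have h6 : w.take g ++ (w.drop g ++ w.take g) = w ++ w.take g := by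
      rw [← List.append_assoc, List.take_append_drop]
    rw [h4] at h6
    exact h6.symm
  have h6 := congrArg List.length (hw.2 _ _ h5.symm)
  omega

theorem Necklace.nodup_words (N : Necklace A) : N.words.Nodup := by
  obtain ⟨c, w, hw, rfl⟩ := N
  rw [Necklace.words, Cycle.lists_coe, Multiset.coe_nodup, List.nodup_iff_injective_get]
  have key : ∀ i j : ℕ, i < j → j < w.length → w.rotate i ≠ w.rotate j := by
    intro i j hij hj h
    refine hw.rotate_ne (d := j - i) (by omega) (by omega) ?_
    apply List.rotate_injective i
    change (w.rotate (j - i)).rotate i = w.rotate i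
    rw [List.rotate_rotate, h]
    congr 1
    omega
  intro i j hij
  rw [List.get_cyclicPermutations, List.get_cyclicPermutations] at hij
  have hl := List.length_cyclicPermutations_of_ne_nil w hw.1
  have hi := i.2
  have hj := j.2
  rcases lt_trichotomy (i : ℕ) j with hlt | heq | hgt
  · exact absurd hij (key _ _ hlt (by omega))
  · exact Fin.ext heq
  · exact absurd hij.symm (key _ _ hgt (by omega))

end Words

section Ordered

/-! Words over a linearly ordered alphabet; `≤` on words is the lexicographic order. -/

variable {A : Type*} [LinearOrder A]

theorem Necklace.words_nonempty (N : Necklace A) : N.words.toFinset.Nonempty := by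
  obtain ⟨c, w, hw, rfl⟩ := N
  exact ⟨w, by rw [Multiset.mem_toFinset, Necklace.mem_words]⟩

/-- The Lyndon word of a necklace: its lexicographically first word. -/
def Necklace.lyndon (N : Necklace A) : List A :=
  N.words.toFinset.min' N.words_nonempty

/-- The number of columns of the table of a multiset of necklaces:
the least common multiple of the lengths of the necklaces. -/
def tableWidth (M : Multiset (Necklace A)) : ℕ := (M.map Necklace.length).lcm

/-- The rows of the table of `M`: the powers `u ^ (l / |u|)`, where `u` is a word of a necklace
in `M` (counted with multiplicity) and `l` is the width, sorted lexicographically. -/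
def table (M : Multiset (Necklace A)) : List (List A) :=
  (M.bind fun N => N.words.map fun u => wpow u (tableWidth M / u.length)).sort (· ≤ ·)

/-- The Burrows-Wheeler transform of a finite multiset of necklaces: the final column of its
table, read from top to bottom. All the rows are nonempty, so that no row is skipped here. -/
def BW (M : Multiset (Necklace A)) : List A := (table M).filterMap List.getLast?

/-- The concatenation, in ascending lexicographic order, of the Lyndon words of the necklaces
in `M`. -/
def lyndonConcat (M : Multiset (Necklace A)) : List A :=
  ((M.map Necklace.lyndon).sort (· ≤ ·)).flatten

end Ordered

/-- A de Bruijn word of span `n` over a finite alphabet with `k` letters: a word `w` of length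
`k ^ n` such that every word of length `n` appears exactly once as a cyclic factor of `w`, that
is, can be read cyclically in `w` from exactly one starting position. -/
def IsDeBruijnWord {A : Type*} [Fintype A] (n : ℕ) (w : List A) : Prop :=
  w.length = Fintype.card A ^ n ∧
    ∀ u : List A, u.length = n → ∃! i : ℕ, i < w.length ∧ (w.rotate i).take n = u

/-- The word `α = 0 1 ⋯ (k - 1)` over the alphabet `{0 < 1 < ⋯ < k - 1}`. -/
def alphaWord (k : ℕ) : List (Fin k) := List.finRange k

end BWT

/-!
The necklaces behind `α ^ (k ^ (n - 1))` are all the necklaces of length dividing `n`: the rows of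
their table are the powers of length `n` of primitive words, that is, all words of length `n`, and
the last letters of these, taken in lexicographic order, run through the alphabet again and again
(`BW_dividingNecklaces`). They are the only ones, because the transform is injective
(`BW_injective`): rotating the words of a necklace permutes them, so that putting the transform in
front of the sorted column of the prefixes of length `j` of the words `u u u ⋯` gives the prefixes
of length `j + 1`, and long prefixes determine the necklaces through their primitive roots.

It remains to show the theorem of Fredricksen, Kessler and Maiorana for the concatenation `C` of
the Lyndon words of length dividing `n`. These words are the primitive roots of the words of
length `n` that are least among their rotations, and passing to the root preserves the order
(`IsLeastRotation.root_le_root`), so `C` is best described through the least rotations. Write `⊤`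
for the last letter and `⊥` for the first. If `u v` is a least rotation and `v` is not a power of
`⊤`, then a larger one begins with `u` (`IsLeastRotation.exists_gt`). Hence the least rotation that
follows `u v` begins with `u`. Every word of length `n` is a rotation `v u` of a least rotation
`u v`. If `v` is not a power of `⊤`, it is read with `v` at the end of the root of `u v`, and `u`
at the beginning of what follows. If `v` is a power of `⊤`, it is read with `u` at the beginning of
the first root that comes from a least rotation with prefix `u`, because what precedes ends in a
run of `⊤` (`exists_last_below`). There are as many words as positions, so `C` is a de Bruijn word
(`isDeBruijnWord_rootConcat`).

For minimality, the explicit positions show that `C` is greedy: if `a < c`, the word `t a` is read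
before `t c` (`IsPosition.lt_of_lt`), where the words `⊤ ⋯ ⊤ ⊥ ⋯ ⊥`, read across the end of `C`,
count as being read first. Let a de Bruijn word `w` have `t a` where `C` has `t c` with `a < c` at
the first difference. Then either `w` has read `t a` before, or `t a = ⊤ ⋯ ⊤ ⊥ ⋯ ⊥`. In the latter
case `w` can continue with letters `⊥` only, and reads `⊥ ⋯ ⊥` a second time.
-/

namespace BWT

/-! ### Lexicographic order on words -/

section ListOrder

variable {A : Type*} [LinearOrder A]

/-- Like `List.nil_le`, for the order relation of Mathlib's linear order on lists. -/
theorem nil_le_word (a : List A) : [] ≤ a :=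
  not_lt.mp (List.not_lt_nil a)

/-- Like `List.cons_le_cons_iff`, for the order relation of Mathlib's linear order on lists. -/
theorem cons_le_cons_word {x y : A} {a b : List A} :
    x :: a ≤ y :: b ↔ x < y ∨ x = y ∧ a ≤ b := by
  rw [← not_lt, List.cons_lt_cons_iff, ← not_lt]
  rcases lt_trichotomy x y with h | rfl | h
  · simp [h, h.not_gt, h.ne']
  · simp
  · simp [h, h.not_gt, h.ne']

theorem append_lt_append_left_iff (a b c : List A) : a ++ b < a ++ c ↔ b < c := by
  induction a with
  | nil => simp
  | cons x a ih => simp [ih]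

theorem append_le_append_left_iff (a b c : List A) : a ++ b ≤ a ++ c ↔ b ≤ c := by
  rw [← not_lt, ← not_lt, append_lt_append_left_iff]

theorem le_of_prefix {a b : List A} (h : a <+: b) : a ≤ b := by
  obtain ⟨c, rfl⟩ := h
  conv_lhs => rw [← List.append_nil a]
  rw [append_le_append_left_iff]
  exact nil_le_word c

theorem take_le_take_of_le {a b : List A} (h : a ≤ b) (m : ℕ) : a.take m ≤ b.take m := by
  induction m generalizing a b with
  | zero => simp
  | succ m ih =>
    cases a with
    | nil => rw [List.take_nil]; exact nil_le_word _
    | cons x a =>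
      cases b with
      | nil => exact absurd (List.nil_lt_cons x a) (not_lt.mpr h)
      | cons y b =>
        rw [cons_le_cons_word] at h
        rw [List.take_succ_cons, List.take_succ_cons, cons_le_cons_word]
        rcases h with h | ⟨h, h'⟩
        · exact Or.inl h
        · exact Or.inr ⟨h, ih h'⟩

theorem lt_of_take_lt_take {a b : List A} {m : ℕ} (h : a.take m < b.take m) : a < b := by
  by_contra hc
  exact absurd (take_le_take_of_le (not_lt.mp hc) m) (not_le.mpr h)

theorem append_lt_append_of_lt {a b : List A} (hl : a.length = b.length) (h : a < b)
    (c d : List A) : a ++ c < b ++ d := by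
  apply lt_of_take_lt_take (m := a.length)
  rw [List.take_left, hl, List.take_left]
  exact h

theorem le_of_append_le_append {a b c d : List A} (hl : a.length = b.length)
    (h : a ++ c ≤ b ++ d) : a ≤ b := by
  by_contra hc
  exact absurd h (not_le.mpr (append_lt_append_of_lt hl.symm (not_le.mp hc) d c))

theorem prefix_of_le_of_le {u x y : List A} (h1 : u ≤ x) (h2 : x ≤ u ++ y) : u <+: x := by
  have h3 := take_le_take_of_le h1 u.length
  have h4 := take_le_take_of_le h2 u.length
  rw [List.take_left] at h4
  rw [List.take_length] at h3
  rw [List.prefix_iff_eq_take]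
  exact le_antisymm h3 h4

theorem lt_of_take_lt_self {x u : List A} (h : x.take u.length < u) : x < u := by
  apply lt_of_take_lt_take (m := u.length)
  rwa [List.take_length]

theorem take_lt_of_lt {x u : List A} (h : x < u) : x.take u.length < u :=
  lt_of_le_of_lt (le_of_prefix (List.take_prefix _ _)) h

/-- Among words of one length, `x ≤ e` is the same as `x < e ++ [b]`. -/
theorem lt_append_singleton_iff {x e : List A} (hl : x.length = e.length) (b : A) :
    x < e ++ [b] ↔ x ≤ e := by
  constructor
  · intro h
    by_contra hc
    have := append_lt_append_of_lt hl.symm (not_le.mp hc) [b] []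
    rw [List.append_nil] at this
    exact absurd h (not_lt.mpr this.le)
  · intro h
    refine lt_of_le_of_lt h ?_
    conv_lhs => rw [← List.append_nil e]
    rw [append_lt_append_left_iff]
    exact List.nil_lt_cons _ _

end ListOrder

/-! ### Powers, rotations and primitive roots -/

section Powers

variable {A : Type*}

@[simp] theorem wpow_zero (u : List A) : wpow u 0 = [] := rfl

theorem wpow_succ (u : List A) (t : ℕ) : wpow u (t + 1) = u ++ wpow u t := by
  simp [wpow, List.replicate_succ]

@[simp] theorem wpow_one (u : List A) : wpow u 1 = u := by simp [wpow_succ]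

@[simp] theorem length_wpow (u : List A) (t : ℕ) : (wpow u t).length = t * u.length := by
  simp [wpow]

theorem wpow_add (u : List A) (s t : ℕ) : wpow u (s + t) = wpow u s ++ wpow u t := by
  simp only [wpow]
  rw [List.replicate_add, List.flatten_append]

theorem wpow_succ' (u : List A) (t : ℕ) : wpow u (t + 1) = wpow u t ++ u := by
  rw [wpow_add, wpow_one]

theorem wpow_wpow (u : List A) (s t : ℕ) : wpow (wpow u s) t = wpow u (s * t) := by
  induction t with
  | zero => simp
  | succ t ih => rw [wpow_succ, ih, Nat.mul_succ, Nat.add_comm, wpow_add]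

theorem wpow_cons_append (a : A) (s : List A) (t : ℕ) :
    wpow (a :: s) t ++ [a] = a :: wpow (s ++ [a]) t := by
  induction t with
  | zero => simp
  | succ t ih => rw [wpow_succ, List.append_assoc, ih, wpow_succ]; simp

theorem rotate_wpow (u : List A) (t d : ℕ) : (wpow u t).rotate d = wpow (u.rotate d) t := by
  have h1 : ∀ v : List A, (wpow v t).rotate 1 = wpow (v.rotate 1) t := by
    intro v
    cases v with
    | nil => simp [wpow]
    | cons a s =>
      cases t with
      | zero => simp
      | succ t =>
        have h := wpow_cons_append a s (t + 1)
        rw [wpow_succ, List.cons_append, List.cons_append, List.cons.injEq] at h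
        rw [wpow_succ, List.cons_append, List.rotate_cons_succ, List.rotate_zero,
          List.rotate_cons_succ, List.rotate_zero]
        exact h.2
  induction d with
  | zero => simp
  | succ d ih => rw [← List.rotate_rotate, ih, h1, List.rotate_rotate]

theorem take_wpow (u : List A) {t : ℕ} (ht : 0 < t) : (wpow u t).take u.length = u := by
  obtain ⟨t, rfl⟩ := Nat.exists_eq_succ_of_ne_zero ht.ne'
  rw [Nat.succ_eq_add_one, wpow_succ, List.take_left]

theorem IsPrimitive.length_pos {u : List A} (hu : IsPrimitive u) : 0 < u.length :=
  List.length_pos_iff.mpr hu.1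

theorem IsPrimitive.rotate {w : List A} (hw : IsPrimitive w) (d : ℕ) :
    IsPrimitive (w.rotate d) := by
  refine ⟨fun h => hw.1 (List.rotate_eq_nil_iff.mp h), fun x t hx => ?_⟩
  have hwl := hw.length_pos
  -- A complementary rotation, which undoes the rotation by `d`.
  obtain ⟨d', hd'⟩ : ∃ d', w.rotate (d + d') = w := by
    refine ⟨w.length * d - d, ?_⟩
    rw [Nat.add_sub_cancel' (Nat.le_mul_of_pos_left _ hwl), List.rotate_length_mul]
  have h1 : wpow (x.rotate d') t = w := by
    rw [← rotate_wpow, hx, List.rotate_rotate, hd']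
  have h2 : x.rotate d' = w := hw.2 _ _ h1
  have h3 : (x.rotate d').rotate d = w.rotate d := by rw [h2]
  have h4 : x.length = w.length := by rw [← h2, List.length_rotate]
  have h5 : t = 1 := by
    have := congrArg List.length hx
    rw [length_wpow, List.length_rotate, h4] at this
    exact Nat.eq_of_mul_eq_mul_right hwl (by omega)
  rw [h5, wpow_one] at hx
  exact hx

/-- The period under rotation of a power of a primitive word is the length of that word. -/
theorem IsPrimitive.rotate_wpow_eq_iff {u : List A} (hu : IsPrimitive u) {t : ℕ} (ht : 0 < t)
    (d : ℕ) : (wpow u t).rotate d = wpow u t ↔ u.length ∣ d := by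
  rw [rotate_wpow]
  constructor
  · intro h
    have h1 : u.rotate d = u := by
      have := congrArg (List.take u.length) h
      rw [take_wpow u ht] at this
      have h2 := take_wpow (u.rotate d) ht
      rw [List.length_rotate] at h2
      rw [← h2, this]
    rw [← List.rotate_mod] at h1
    by_contra hd
    exact hu.rotate_ne (Nat.pos_of_ne_zero fun h => hd (Nat.dvd_of_mod_eq_zero h))
      (Nat.mod_lt _ hu.length_pos) h1
  · rintro ⟨c, rfl⟩
    rw [List.rotate_length_mul]

/-- A word is a power of at most one primitive word. -/
theorem IsPrimitive.eq_of_wpow_eq {u v : List A} (hu : IsPrimitive u) (hv : IsPrimitive v)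
    {s t : ℕ} (hs : 0 < s) (h : wpow u s = wpow v t) : u = v := by
  have ht : 0 < t := by
    refine Nat.pos_of_ne_zero fun h0 => ?_
    have := congrArg List.length h
    rw [h0, length_wpow, length_wpow] at this
    have := Nat.mul_pos hs hu.length_pos
    omega
  have h1 : u.length ∣ v.length := by
    rw [← hu.rotate_wpow_eq_iff hs, h, rotate_wpow, List.rotate_length]
  have h2 : v.length ∣ u.length := by
    rw [← hv.rotate_wpow_eq_iff ht, ← h, rotate_wpow, List.rotate_length]
  have h3 := Nat.dvd_antisymm h1 h2
  rw [← take_wpow u hs, h, h3, take_wpow v ht]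

theorem exists_primitive_wpow_eq (w : List A) (hw : w ≠ []) :
    ∃ u t, IsPrimitive u ∧ wpow u t = w := by
  induction hl : w.length using Nat.strong_induction_on generalizing w with
  | _ m ih =>
    by_cases hp : IsPrimitive w
    · exact ⟨w, 1, hp, wpow_one w⟩
    · simp only [IsPrimitive, not_and, not_forall] at hp
      obtain ⟨u, t, h, hne⟩ := hp hw
      have hu : u ≠ [] := by
        rintro rfl
        apply hw
        rw [← h]
        simp [wpow]
      have hul := List.length_pos_iff.mpr hu
      have hlt : u.length < m := by
        rw [← hl, ← h, length_wpow]
        match t, h with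
        | 0, h => exact absurd h.symm hw
        | 1, h => exact absurd (by rw [← h, wpow_one]) hne
        | t + 2, h => nlinarith [Nat.zero_le (t * u.length)]
      obtain ⟨v, s, hv, hvs⟩ := ih _ hlt u hu rfl
      exact ⟨v, s * t, hv, by rw [← wpow_wpow, hvs, h]⟩

open Classical in
/-- The primitive root of a nonempty word: the primitive word of which it is a power
(the empty word for the empty word). -/
noncomputable def root (w : List A) : List A :=
  if h : w ≠ [] then (exists_primitive_wpow_eq w h).choose else []

theorem isPrimitive_root {w : List A} (h : w ≠ []) : IsPrimitive (root w) := by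
  rw [root, dif_pos h]
  exact (exists_primitive_wpow_eq w h).choose_spec.choose_spec.1

theorem length_root_pos {w : List A} (h : w ≠ []) : 0 < (root w).length :=
  (isPrimitive_root h).length_pos

theorem exists_wpow_root {w : List A} (h : w ≠ []) : ∃ t, 0 < t ∧ wpow (root w) t = w := by
  obtain ⟨t, ht⟩ : ∃ t, wpow (root w) t = w := by
    rw [root, dif_pos h]
    exact ⟨_, (exists_primitive_wpow_eq w h).choose_spec.choose_spec.2⟩
  refine ⟨t, Nat.pos_of_ne_zero ?_, ht⟩
  rintro rfl
  exact h ht.symm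

theorem length_root_dvd {w : List A} (h : w ≠ []) : (root w).length ∣ w.length := by
  obtain ⟨t, -, ht⟩ := exists_wpow_root h
  conv_rhs => rw [← ht, length_wpow]
  exact Nat.dvd_mul_left _ _

theorem wpow_root {w : List A} (h : w ≠ []) : wpow (root w) (w.length / (root w).length) = w := by
  obtain ⟨t, -, ht⟩ := exists_wpow_root h
  have h1 : w.length = t * (root w).length := by
    conv_lhs => rw [← ht, length_wpow]
  rw [h1, Nat.mul_div_cancel _ (length_root_pos h), ht]

theorem root_wpow {u : List A} (hu : IsPrimitive u) {t : ℕ} (ht : 0 < t) :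
    root (wpow u t) = u := by
  have hne : wpow u t ≠ [] := by
    rw [← List.length_pos_iff, length_wpow]
    exact Nat.mul_pos ht hu.length_pos
  obtain ⟨s, hs, h⟩ := exists_wpow_root hne
  exact (isPrimitive_root hne).eq_of_wpow_eq hu hs h

theorem length_root_le {w : List A} (h : w ≠ []) : (root w).length ≤ w.length :=
  Nat.le_of_dvd (List.length_pos_iff.mpr h) (length_root_dvd h)

theorem root_prefix {w : List A} (h : w ≠ []) : root w <+: w := by
  obtain ⟨t, ht0, ht⟩ := exists_wpow_root h
  obtain ⟨t, rfl⟩ := Nat.exists_eq_succ_of_ne_zero ht0.ne'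
  conv_rhs => rw [← ht, Nat.succ_eq_add_one, wpow_succ]
  exact List.prefix_append _ _

theorem root_suffix {w : List A} (h : w ≠ []) : root w <:+ w := by
  obtain ⟨t, ht0, ht⟩ := exists_wpow_root h
  obtain ⟨t, rfl⟩ := Nat.exists_eq_succ_of_ne_zero ht0.ne'
  conv_rhs => rw [← ht, Nat.succ_eq_add_one, wpow_succ']
  exact List.suffix_append _ _

/-- The word of length `j` that begins the infinite power `u u u ⋯`. -/
def powPrefix (u : List A) (j : ℕ) : List A := (wpow u j).take j

theorem powPrefix_eq_take {u : List A} (hu : u ≠ []) {j t : ℕ} (h : j ≤ t) :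
    powPrefix u j = (wpow u t).take j := by
  have := List.length_pos_iff.mpr hu
  obtain ⟨s, rfl⟩ := Nat.exists_eq_add_of_le h
  rw [powPrefix, wpow_add, List.take_append_of_le_length]
  rw [length_wpow]
  exact Nat.le_mul_of_pos_right _ this

theorem powPrefix_wpow {u : List A} (hu : u ≠ []) {t : ℕ} (ht : 0 < t) (j : ℕ) :
    powPrefix (wpow u t) j = powPrefix u j := by
  rw [powPrefix, wpow_wpow, ← powPrefix_eq_take hu (Nat.le_mul_of_pos_left _ ht)]

theorem powPrefix_mul_length {u : List A} (hu : u ≠ []) (t : ℕ) :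
    powPrefix u (t * u.length) = wpow u t := by
  have := List.length_pos_iff.mpr hu
  have h1 : t ≤ t * u.length := Nat.le_mul_of_pos_right _ this
  obtain ⟨s, hs⟩ := Nat.exists_eq_add_of_le h1
  rw [powPrefix]
  conv_lhs => rw [hs, wpow_add, ← hs, ← length_wpow, List.take_left]

theorem powPrefix_cons_succ (a : A) (s : List A) (j : ℕ) :
    powPrefix (a :: s) (j + 1) = a :: powPrefix (s ++ [a]) j := by
  have h := wpow_cons_append a s (j + 1)
  have h1 : powPrefix (a :: s) (j + 1) = (wpow (a :: s) (j + 1) ++ [a]).take (j + 1) := by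
    rw [powPrefix, List.take_append_of_le_length]
    rw [length_wpow]
    exact Nat.le_mul_of_pos_right _ (by simp)
  rw [h1, h, List.take_succ_cons, ← powPrefix_eq_take (by simp) (Nat.le_succ j)]

theorem powPrefix_le_powPrefix [LinearOrder A] {r s : List A} (hl : r.length = s.length)
    (h : r ≤ s) (j : ℕ) : powPrefix r j ≤ powPrefix s j := by
  apply take_le_take_of_le
  rcases h.eq_or_lt with rfl | h
  · exact le_rfl
  · cases j with
    | zero => simp
    | succ j =>
      rw [wpow_succ, wpow_succ]
      exact (append_lt_append_of_lt hl h _ _).le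

end Powers

/-! ### The table of a multiset of necklaces -/

section Rows

variable {A : Type*}

theorem Necklace.isPrimitive_of_mem {N : Necklace A} {u : List A} (hu : u ∈ N.words) :
    IsPrimitive u := by
  obtain ⟨w, hw, hc⟩ := N.exists_primitive
  rw [N.mem_words, ← hc, Cycle.coe_eq_coe] at hu
  obtain ⟨d, hd⟩ := hu.symm
  rw [← hd]
  exact hw.rotate d

theorem Necklace.length_of_mem {N : Necklace A} {u : List A} (hu : u ∈ N.words) :
    u.length = N.length := by
  rw [N.mem_words] at hu
  rw [Necklace.length, ← hu, Cycle.length_coe]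

theorem Necklace.exists_mem_words (N : Necklace A) : ∃ u, u ∈ N.words := by
  obtain ⟨w, -, hc⟩ := N.exists_primitive
  exact ⟨w, (N.mem_words w).mpr hc⟩

theorem Necklace.length_pos (N : Necklace A) : 0 < N.length := by
  obtain ⟨u, hu⟩ := N.exists_mem_words
  rw [← Necklace.length_of_mem hu]
  exact (Necklace.isPrimitive_of_mem hu).length_pos

theorem Necklace.card_words (N : Necklace A) : Multiset.card N.words = N.length := by
  obtain ⟨c, w, hw, rfl⟩ := N
  simp [Necklace.words, Necklace.length, List.length_cyclicPermutations_of_ne_nil w hw.1]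

theorem Necklace.map_rotate_words (N : Necklace A) :
    N.words.map (fun u => u.rotate 1) = N.words := by
  rw [Multiset.Nodup.ext (N.nodup_words.map (List.rotate_injective 1)) N.nodup_words]
  intro u
  rw [Multiset.mem_map]
  constructor
  · rintro ⟨v, hv, rfl⟩
    rw [N.mem_words] at hv ⊢
    rw [← hv, Cycle.coe_eq_coe]
    exact List.IsRotated.symm ⟨1, rfl⟩
  · intro hu
    obtain ⟨v, hv⟩ : ∃ v : List A, v.rotate 1 = u := by
      refine ⟨u.rotate (u.length - 1), ?_⟩
      have := (Necklace.isPrimitive_of_mem hu).length_pos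
      rw [List.rotate_rotate, Nat.sub_add_cancel this, List.rotate_length]
    refine ⟨v, ?_, hv⟩
    rw [N.mem_words] at hu ⊢
    rw [← hu, Cycle.coe_eq_coe]
    exact ⟨1, hv⟩

/-- The prefixes of length `j` of the infinite powers `u u u ⋯` of the words of the necklaces
in `M`, with multiplicity. -/
def powPrefixes (M : Multiset (Necklace A)) (j : ℕ) : Multiset (List A) :=
  M.bind fun N => N.words.map fun u => powPrefix u j

/-- Rotating the words of a necklace permutes them; hence the prefixes of length `j + 1` arise
from those of length `j` by putting in front of each the last letter of its word. -/
theorem powPrefixes_succ (M : Multiset (Necklace A)) (j : ℕ) :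
    powPrefixes M (j + 1) =
      M.bind fun N => N.words.map fun u => u.getLast?.toList ++ powPrefix u j := by
  refine Multiset.bind_congr fun N _ => ?_
  conv_rhs => rw [← N.map_rotate_words]
  rw [Multiset.map_map]
  refine Multiset.map_congr rfl fun u hu => ?_
  cases u with
  | nil => exact absurd rfl (Necklace.isPrimitive_of_mem hu).1
  | cons a s => simp [powPrefix_cons_succ]

theorem count_bind_replicate_cycle [DecidableEq (Cycle A)] [DecidableEq (Necklace A)]
    (M : Multiset (Necklace A)) (N : Necklace A) :
    (M.bind fun N' => Multiset.replicate N'.length N'.cycle).count N.cycle =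
      N.length * M.count N := by
  induction M using Multiset.induction_on with
  | empty => simp
  | cons N' M ih =>
    rw [Multiset.cons_bind, Multiset.count_add, ih, Multiset.count_cons,
      Multiset.count_replicate]
    by_cases h : N = N'
    · subst h
      simp [Nat.mul_add, Nat.add_comm]
    · have h' : N'.cycle ≠ N.cycle := fun hc => h (Necklace.ext hc.symm)
      simp [h, h']

/-- A multiset of necklaces is recovered from the prefixes of a length divisible by the lengths
of all its members: their primitive roots are the words of the necklaces. -/
theorem map_root_powPrefixes (M : Multiset (Necklace A)) {L : ℕ} (hL : 0 < L)
    (h : ∀ N ∈ M, N.length ∣ L) :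
    (powPrefixes M L).map (fun x => (root x : Cycle A)) =
      M.bind fun N => Multiset.replicate N.length N.cycle := by
  rw [powPrefixes, Multiset.map_bind]
  refine Multiset.bind_congr fun N hN => ?_
  rw [Multiset.map_map, Multiset.eq_replicate]
  refine ⟨by rw [Multiset.card_map, N.card_words], fun c hc => ?_⟩
  obtain ⟨u, hu, rfl⟩ := Multiset.mem_map.mp hc
  obtain ⟨t, rfl⟩ := h N hN
  have hp := Necklace.isPrimitive_of_mem hu
  rw [Function.comp_apply, ← Necklace.length_of_mem hu, Nat.mul_comm,
    powPrefix_mul_length hp.1, root_wpow hp (Nat.pos_of_mul_pos_left hL)]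
  exact (N.mem_words u).mp hu

theorem dvd_tableWidth {M : Multiset (Necklace A)} {N : Necklace A} (hN : N ∈ M) :
    N.length ∣ tableWidth M :=
  Multiset.dvd_lcm (Multiset.mem_map_of_mem _ hN)

theorem tableWidth_pos (M : Multiset (Necklace A)) : 0 < tableWidth M := by
  refine Nat.pos_of_ne_zero fun h => ?_
  rw [tableWidth, Multiset.lcm_eq_zero_iff] at h
  obtain ⟨N, -, hN⟩ := Multiset.mem_map.mp h
  exact N.length_pos.ne' hN

theorem filterMap_getLast?_zipWith {B : Type*} (T : List (List A)) (hT : ∀ r ∈ T, r ≠ [])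
    (f : List A → List B) (g : A → List B → List B) :
    List.zipWith g (T.filterMap List.getLast?) (T.map f) =
      T.map fun r => (r.getLast?.map fun a => g a (f r)).getD [] := by
  induction T with
  | nil => simp
  | cons r T ih =>
    have hr : r ≠ [] := hT r (by simp)
    rw [List.filterMap_cons, List.getLast?_eq_getLast_of_ne_nil hr]
    simp [ih fun r hr => hT r (by simp [hr]), List.getLast?_eq_getLast_of_ne_nil hr]

theorem getLast?_wpow (u : List A) {t : ℕ} (ht : 0 < t) :
    (wpow u t).getLast? = u.getLast? := by
  obtain ⟨t, rfl⟩ := Nat.exists_eq_succ_of_ne_zero ht.ne'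
  induction t with
  | zero => simp
  | succ t ih =>
    rw [Nat.succ_eq_add_one, wpow_succ, List.getLast?_append, ih (Nat.succ_pos t)]
    cases u.getLast? <;> rfl

end Rows

/-! ### Injectivity of the transform -/

section Injective

variable {A : Type*} [LinearOrder A]

theorem coe_table (M : Multiset (Necklace A)) :
    (table M : Multiset (List A)) =
      M.bind fun N => N.words.map fun u => wpow u (tableWidth M / u.length) :=
  Multiset.sort_eq _ _

theorem exists_of_mem_table {M : Multiset (Necklace A)} {r : List A} (hr : r ∈ table M) :
    ∃ u t, IsPrimitive u ∧ 0 < t ∧ r = wpow u t ∧ r.length = tableWidth M := by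
  rw [← Multiset.mem_coe, coe_table, Multiset.mem_bind] at hr
  obtain ⟨N, hN, hr⟩ := hr
  obtain ⟨u, hu, rfl⟩ := Multiset.mem_map.mp hr
  have hp := Necklace.isPrimitive_of_mem hu
  have hd : u.length ∣ tableWidth M := by
    rw [Necklace.length_of_mem hu]
    exact dvd_tableWidth hN
  exact ⟨u, _, hp, Nat.div_pos (Nat.le_of_dvd (tableWidth_pos M) hd) hp.length_pos, rfl,
    by rw [length_wpow, Nat.div_mul_cancel hd]⟩

theorem ne_nil_of_mem_table {M : Multiset (Necklace A)} {r : List A} (hr : r ∈ table M) :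
    r ≠ [] := by
  obtain ⟨-, -, -, -, -, h⟩ := exists_of_mem_table hr
  rw [← List.length_pos_iff, h]
  exact tableWidth_pos M

theorem coe_map_table {B : Type*} (M : Multiset (Necklace A)) (f : List A → B)
    (hf : ∀ u t, IsPrimitive u → 0 < t → f (wpow u t) = f u) :
    ((table M).map f : Multiset B) = M.bind fun N => N.words.map f := by
  rw [← Multiset.map_coe, coe_table, Multiset.map_bind]
  refine Multiset.bind_congr fun N hN => ?_
  rw [Multiset.map_map]
  refine Multiset.map_congr rfl fun u hu => ?_
  have hp := Necklace.isPrimitive_of_mem hu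
  refine hf u _ hp (Nat.div_pos (Nat.le_of_dvd (tableWidth_pos M) ?_) hp.length_pos)
  rw [Necklace.length_of_mem hu]
  exact dvd_tableWidth hN

theorem map_powPrefix_table (M : Multiset (Necklace A)) (j : ℕ) :
    (table M).map (fun r => powPrefix r j) = (powPrefixes M j).sort (· ≤ ·) := by
  refine List.Perm.eq_of_pairwise' (r := (· ≤ ·)) ?_ (Multiset.pairwise_sort _ _) ?_
  · rw [List.pairwise_map]
    refine List.Pairwise.imp_of_mem ?_ (Multiset.pairwise_sort _ _)
    intro a b ha hb hab
    obtain ⟨-, -, -, -, -, ha⟩ := exists_of_mem_table ha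
    obtain ⟨-, -, -, -, -, hb⟩ := exists_of_mem_table hb
    exact powPrefix_le_powPrefix (ha.trans hb.symm) hab j
  · rw [← Multiset.coe_eq_coe, Multiset.sort_eq, coe_map_table _ _ _]
    · rfl
    · intro u t hu ht
      exact powPrefix_wpow hu.1 ht j

/-- The inversion of the transform: each column of prefixes is obtained from the sorted column
of the prefixes one letter shorter by putting the transform in front of it. -/
theorem powPrefixes_succ_eq_zipWith (M : Multiset (Necklace A)) (j : ℕ) :
    powPrefixes M (j + 1) =
      (List.zipWith List.cons (BW M) ((powPrefixes M j).sort (· ≤ ·)) : Multiset (List A)) := by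
  rw [← map_powPrefix_table, BW,
    filterMap_getLast?_zipWith _ (fun r hr => ne_nil_of_mem_table hr), coe_map_table,
    powPrefixes_succ]
  · refine Multiset.bind_congr fun N _ => Multiset.map_congr rfl fun u hu => ?_
    rw [List.getLast?_eq_getLast_of_ne_nil (Necklace.isPrimitive_of_mem hu).1]
    simp
  · intro u t hu ht
    rw [getLast?_wpow u ht, powPrefix_wpow hu.1 ht]

theorem length_BW (M : Multiset (Necklace A)) : (BW M).length = (table M).length := by
  have h : ∀ T : List (List A), (∀ r ∈ T, r ≠ []) →
      (T.filterMap List.getLast?).length = T.length := by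
    intro T hT
    induction T with
    | nil => rfl
    | cons r T ih =>
      rw [List.filterMap_cons, List.getLast?_eq_getLast_of_ne_nil (hT r (by simp))]
      simp [ih fun r hr => hT r (by simp [hr])]
  exact h _ fun r hr => ne_nil_of_mem_table hr

theorem powPrefixes_zero (M : Multiset (Necklace A)) :
    powPrefixes M 0 = Multiset.replicate (BW M).length [] := by
  have h := map_powPrefix_table M 0
  rw [← Multiset.sort_eq (powPrefixes M 0) (· ≤ ·), ← h, length_BW]
  simp [powPrefix]
  rfl

theorem powPrefixes_eq_of_BW_eq {M M' : Multiset (Necklace A)} (h : BW M = BW M') (j : ℕ) :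
    powPrefixes M j = powPrefixes M' j := by
  induction j with
  | zero => rw [powPrefixes_zero, powPrefixes_zero, h]
  | succ j ih => rw [powPrefixes_succ_eq_zipWith, powPrefixes_succ_eq_zipWith, h, ih]

/-- A multiset of necklaces is determined by its Burrows-Wheeler transform. -/
theorem BW_injective : Function.Injective (BW : Multiset (Necklace A) → List A) := by
  classical
  intro M M' h
  have hL := Nat.mul_pos (tableWidth_pos M) (tableWidth_pos M')
  have h1 := map_root_powPrefixes M hL fun N hN => (dvd_tableWidth hN).mul_right _
  have h2 := map_root_powPrefixes M' hL fun N hN => (dvd_tableWidth hN).mul_left _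
  rw [powPrefixes_eq_of_BW_eq h, h2] at h1
  ext N
  have h3 := congrArg (Multiset.count N.cycle) h1
  rw [count_bind_replicate_cycle, count_bind_replicate_cycle] at h3
  exact (Nat.eq_of_mul_eq_mul_left N.length_pos h3).symm

end Injective

/-! ### Words that are least among their rotations -/

section LeastRotation

variable {A : Type*} [LinearOrder A]

/-- A word that is lexicographically least among its rotations. These are the powers of the
Lyndon words. -/
def IsLeastRotation (w : List A) : Prop := ∀ i : ℕ, w ≤ w.rotate i

theorem exists_isLeastRotation_rotate (w : List A) : ∃ i, IsLeastRotation (w.rotate i) := by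
  have h : ∃ x ∈ w.cyclicPermutations.toFinset, ∀ y ∈ w.cyclicPermutations.toFinset, x ≤ y := by
    refine Finset.exists_min_image _ id ⟨w, ?_⟩
    rw [List.mem_toFinset, List.mem_cyclicPermutations_iff]
  obtain ⟨x, hx, hmin⟩ := h
  rw [List.mem_toFinset, List.mem_cyclicPermutations_iff] at hx
  obtain ⟨i, hi⟩ := hx.symm
  refine ⟨i, fun j => ?_⟩
  rw [hi]
  refine hmin _ ?_
  rw [List.mem_toFinset, List.mem_cyclicPermutations_iff]
  exact (List.IsRotated.symm ⟨j, rfl⟩).trans hx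

theorem IsLeastRotation.le_of_isRotated {e x : List A} (he : IsLeastRotation e) (h : e ~r x) :
    e ≤ x := by
  obtain ⟨i, rfl⟩ := h
  exact he i

theorem IsLeastRotation.eq_of_isRotated {e e' : List A} (he : IsLeastRotation e)
    (he' : IsLeastRotation e') (h : e ~r e') : e = e' :=
  le_antisymm (he.le_of_isRotated h) (he'.le_of_isRotated h.symm)

theorem IsLeastRotation.append_le {u v : List A} (h : IsLeastRotation (u ++ v)) :
    u ++ v ≤ v ++ u :=
  h.le_of_isRotated List.isRotated_append

theorem IsLeastRotation.root_le {e : List A} (he : IsLeastRotation e) (hne : e ≠ [])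
    (i : ℕ) : root e ≤ (root e).rotate i := by
  obtain ⟨t, ht0, ht⟩ := exists_wpow_root hne
  have h := he i
  rw [← ht, rotate_wpow] at h
  have h1 := take_le_take_of_le h (root e).length
  rwa [ht, ← ht, root_wpow (isPrimitive_root hne) ht0, take_wpow _ ht0,
    ← List.length_rotate (root e) i, take_wpow _ ht0] at h1

/-- Every suffix of a least rotation is, up to its length, at least as large as the word; so a
least rotation beginning with `p` is at least `p p p ⋯`. -/
theorem IsLeastRotation.wpow_le {e p : List A} (he : IsLeastRotation e) (hp : p <+: e) (m : ℕ)
    (hm : m * p.length ≤ e.length) : wpow p m ≤ e := by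
  obtain ⟨s, rfl⟩ := hp
  induction m with
  | zero => exact nil_le_word _
  | succ m ih =>
    have hle : m * p.length ≤ s.length := by
      rw [List.length_append, Nat.succ_mul] at hm
      omega
    rw [wpow_succ, append_le_append_left_iff]
    have h1 := take_le_take_of_le ((ih (by rw [List.length_append]; omega)).trans he.append_le)
      (m * p.length)
    rw [List.take_append_of_le_length hle, ← length_wpow, List.take_length] at h1
    exact h1.trans (le_of_prefix (List.take_prefix _ _))

/-- Passing to the Lyndon root is monotone on least rotations of a fixed length. -/
theorem IsLeastRotation.root_le_root {e e' : List A} (he : IsLeastRotation e)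
    (hne : e ≠ []) (hl : e.length = e'.length) (h : e ≤ e') : root e ≤ root e' := by
  have hne' : e' ≠ [] := by
    rw [← List.length_pos_iff] at hne ⊢
    omega
  by_contra hc
  have h1 : root e' ≤ e := (not_le.mp hc).le.trans (le_of_prefix (root_prefix hne))
  have h2 : root e' <+: e := by
    obtain ⟨y, hy⟩ := root_prefix hne'
    exact prefix_of_le_of_le h1 (y := y) (by rwa [hy])
  obtain ⟨t, -, ht⟩ := exists_wpow_root hne'
  have h3 : e' ≤ e := by
    have h4 := he.wpow_le h2 t (by rw [hl, ← length_wpow, ht])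
    rwa [ht] at h4
  exact hc (by rw [le_antisymm h h3])

/-- The necklace of the primitive root of a nonempty word. -/
noncomputable def rootNecklace (w : List A) (hw : w ≠ []) : Necklace A :=
  ⟨root w, root w, isPrimitive_root hw, rfl⟩

omit [LinearOrder A] in
theorem mem_words_rootNecklace {w : List A} (hw : w ≠ []) (u : List A) :
    u ∈ (rootNecklace w hw).words ↔ root w ~r u := by
  rw [Necklace.mem_words, rootNecklace, Cycle.coe_eq_coe, List.isRotated_comm]

omit [LinearOrder A] in
theorem length_rootNecklace {w : List A} (hw : w ≠ []) :
    (rootNecklace w hw).length = (root w).length := rfl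

theorem IsLeastRotation.lyndon_rootNecklace {e : List A} (he : IsLeastRotation e)
    (hne : e ≠ []) : (rootNecklace e hne).lyndon = root e := by
  apply le_antisymm
  · apply Finset.min'_le
    rw [Multiset.mem_toFinset, mem_words_rootNecklace]
  · apply Finset.le_min'
    intro y hy
    rw [Multiset.mem_toFinset, mem_words_rootNecklace] at hy
    obtain ⟨i, rfl⟩ := hy
    exact he.root_le hne i

end LeastRotation

/-! ### The necklaces of length dividing `n` -/

section AllWords

variable (A : Type*) [LinearOrder A] [Fintype A]

/-- The words of length `n`, in ascending order. -/
def allWords : ℕ → List (List A)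
  | 0 => [[]]
  | n + 1 => (allWords n).flatMap fun x => (Finset.univ.sort (· ≤ ·)).map fun a => x ++ [a]

variable {A}

theorem mem_allWords {n : ℕ} {w : List A} : w ∈ allWords A n ↔ w.length = n := by
  induction n generalizing w with
  | zero => simp [allWords]
  | succ n ih =>
    simp only [allWords, List.mem_flatMap, List.mem_map, Finset.mem_sort, Finset.mem_univ,
      true_and, ih]
    constructor
    · rintro ⟨x, hx, a, rfl⟩
      simp [hx]
    · intro h
      have hne : w ≠ [] := by
        rintro rfl
        simp at h
      exact ⟨w.dropLast, by simp [h], w.getLast hne, List.dropLast_append_getLast hne⟩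

theorem length_allWords (n : ℕ) : (allWords A n).length = Fintype.card A ^ n := by
  induction n with
  | zero => rfl
  | succ n ih => simp [allWords, List.length_flatMap, ih, pow_succ]

theorem sorted_allWords (n : ℕ) : (allWords A n).Pairwise (· < ·) := by
  induction n with
  | zero => simp [allWords]
  | succ n ih =>
    rw [allWords, List.pairwise_flatMap]
    constructor
    · intro x _
      rw [List.pairwise_map]
      refine List.Pairwise.imp ?_ (Finset.sortedLT_sort _).pairwise
      intro a b hab
      rw [append_lt_append_left_iff]
      exact List.Lex.rel hab
    · refine ih.imp_of_mem ?_
      intro x y hx hy hxy u hu v hv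
      obtain ⟨a, -, rfl⟩ := List.mem_map.mp hu
      obtain ⟨b, -, rfl⟩ := List.mem_map.mp hv
      rw [mem_allWords] at hx hy
      exact append_lt_append_of_lt (hx.trans hy.symm) hxy _ _

theorem filterMap_getLast?_allWords (n : ℕ) :
    (allWords A (n + 1)).filterMap List.getLast? =
      wpow (Finset.univ.sort (· ≤ ·)) (Fintype.card A ^ n) := by
  have h : ∀ L : List (List A), (L.flatMap fun x =>
      (Finset.univ.sort (· ≤ ·)).map fun a : A => x ++ [a]).filterMap List.getLast? =
        wpow (Finset.univ.sort (· ≤ ·)) L.length := by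
    intro L
    induction L with
    | nil => rfl
    | cons x L ih =>
      rw [List.flatMap_cons, List.filterMap_append, ih, List.length_cons, wpow_succ,
        List.filterMap_map]
      congr 1
      have : (List.getLast? ∘ fun a : A => x ++ [a]) = some := by
        funext a
        simp
      rw [this, List.filterMap_some]
  rw [allWords, h, length_allWords]

variable (A) in
open Classical in
/-- The words of length `n` that are least among their rotations, in ascending order. -/
noncomputable def leastRotations (n : ℕ) : List (List A) :=
  (allWords A n).filter fun w => IsLeastRotation w

theorem mem_leastRotations {n : ℕ} {w : List A} :
    w ∈ leastRotations A n ↔ w.length = n ∧ IsLeastRotation w := by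
  simp [leastRotations, mem_allWords]

theorem sorted_leastRotations (n : ℕ) : (leastRotations A n).Pairwise (· < ·) :=
  (sorted_allWords n).filter _

theorem ne_nil_of_mem_leastRotations {n : ℕ} (hn : 0 < n) {w : List A}
    (hw : w ∈ leastRotations A n) : w ≠ [] := by
  rw [← List.length_pos_iff, (mem_leastRotations.mp hw).1]
  exact hn

variable (A) in
/-- All the necklaces whose length divides `n`. -/
noncomputable def dividingNecklaces {n : ℕ} (hn : 0 < n) : Multiset (Necklace A) :=
  ((leastRotations A n).attach.map fun e =>
    rootNecklace e.1 (ne_nil_of_mem_leastRotations hn e.2) : List (Necklace A))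

theorem mem_dividingNecklaces {n : ℕ} (hn : 0 < n) {N : Necklace A} :
    N ∈ dividingNecklaces A hn ↔
      ∃ e, ∃ h : e ∈ leastRotations A n,
        rootNecklace e (ne_nil_of_mem_leastRotations hn h) = N := by
  simp [dividingNecklaces]

theorem exists_mem_leastRotations_isRotated (w : List A) :
    ∃ e ∈ leastRotations A w.length, e ~r w := by
  obtain ⟨i, hi⟩ := exists_isLeastRotation_rotate w
  exact ⟨_, mem_leastRotations.mpr ⟨List.length_rotate _ _, hi⟩, List.IsRotated.symm ⟨i, rfl⟩⟩

theorem tableWidth_dividingNecklaces [Nontrivial A] {n : ℕ} (hn : 0 < n) :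
    tableWidth (dividingNecklaces A hn) = n := by
  apply Nat.dvd_antisymm
  · refine Multiset.lcm_dvd.mpr fun d hd => ?_
    obtain ⟨N, hN, rfl⟩ := Multiset.mem_map.mp hd
    obtain ⟨e, he, rfl⟩ := (mem_dividingNecklaces hn).mp hN
    have h := length_root_dvd (ne_nil_of_mem_leastRotations hn he)
    rwa [(mem_leastRotations.mp he).1] at h
  · -- A word with a single occurrence of one of its letters is primitive.
    obtain ⟨a, b, hab⟩ := exists_pair_ne A
    have hlen : (b :: List.replicate (n - 1) a).length = n := by
      simp
      omega
    obtain ⟨e, he, hr⟩ := exists_mem_leastRotations_isRotated (b :: List.replicate (n - 1) a)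
    rw [hlen] at he
    have hne := ne_nil_of_mem_leastRotations hn he
    obtain ⟨t, -, ht⟩ := exists_wpow_root hne
    have hc : e.count b = 1 := by
      rw [hr.perm.count_eq, List.count_cons, List.count_replicate]
      simp [hab]
    have ht1 : t = 1 := by
      rw [← ht, wpow, List.count_flatten, List.map_replicate, List.sum_replicate, smul_eq_mul]
        at hc
      exact Nat.eq_one_of_mul_eq_one_right hc
    rw [ht1, wpow_one] at ht
    have h := dvd_tableWidth ((mem_dividingNecklaces hn).mpr ⟨e, he, rfl⟩)
    rwa [length_rootNecklace, ht, (mem_leastRotations.mp he).1] at h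

/-- The rows of the table of all necklaces of length dividing `n` are all words of length `n`. -/
theorem table_dividingNecklaces [Nontrivial A] {n : ℕ} (hn : 0 < n) :
    table (dividingNecklaces A hn) = allWords A n := by
  have hw := tableWidth_dividingNecklaces (A := A) hn
  refine List.Perm.eq_of_pairwise' (r := (· ≤ ·)) (Multiset.pairwise_sort _ _)
    ((sorted_allWords n).imp fun h => h.le) ?_
  rw [← Multiset.coe_eq_coe, coe_table, hw]
  have hmem : ∀ e, (h : e ∈ leastRotations A n) → ∀ x,
      x ∈ (rootNecklace e (ne_nil_of_mem_leastRotations hn h)).words.map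
        (fun u => wpow u (n / u.length)) ↔ e ~r x := by
    intro e he x
    have hne := ne_nil_of_mem_leastRotations hn he
    have hel := (mem_leastRotations.mp he).1
    have key : ∀ i, wpow ((root e).rotate i) (n / ((root e).rotate i).length) = e.rotate i := by
      intro i
      rw [List.length_rotate, ← rotate_wpow, ← hel, wpow_root hne]
    rw [Multiset.mem_map]
    constructor
    · rintro ⟨u, hu, rfl⟩
      rw [mem_words_rootNecklace] at hu
      obtain ⟨i, rfl⟩ := hu
      exact ⟨i, (key i).symm⟩
    · rintro ⟨i, rfl⟩
      exact ⟨_, (mem_words_rootNecklace hne _).mpr ⟨i, rfl⟩, key i⟩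
  rw [Multiset.Nodup.ext]
  · intro x
    rw [Multiset.mem_coe, mem_allWords, Multiset.mem_bind]
    constructor
    · rintro ⟨N, hN, hx⟩
      obtain ⟨e, he, rfl⟩ := (mem_dividingNecklaces hn).mp hN
      rw [hmem e he] at hx
      rw [← hx.perm.length_eq, (mem_leastRotations.mp he).1]
    · rintro rfl
      obtain ⟨e, he, hr⟩ := exists_mem_leastRotations_isRotated x
      exact ⟨_, (mem_dividingNecklaces hn).mpr ⟨e, he, rfl⟩, (hmem e he x).mpr hr⟩
  · rw [Multiset.nodup_bind]
    constructor
    · intro N hN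
      refine Multiset.Nodup.map_on ?_ N.nodup_words
      intro u hu v hv huv
      have hN' : 0 < n / u.length := by
        have h := dvd_tableWidth hN
        rw [hw] at h
        rw [Necklace.length_of_mem hu]
        exact Nat.div_pos (Nat.le_of_dvd hn h) N.length_pos
      exact (Necklace.isPrimitive_of_mem hu).eq_of_wpow_eq (Necklace.isPrimitive_of_mem hv) hN' huv
    · refine ⟨_, rfl, ?_⟩
      rw [List.pairwise_map]
      have hp : (leastRotations A n).attach.Pairwise fun a b => a.1 < b.1 := by
        rw [← List.pairwise_map (f := Subtype.val) (R := (· < ·)), List.attach_map_subtype_val]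
        exact sorted_leastRotations n
      refine hp.imp ?_
      rintro ⟨e, he⟩ ⟨e', he'⟩ hlt
      simp only [Function.onFun]
      rw [Multiset.disjoint_left]
      intro x hx hx'
      rw [hmem e he] at hx
      rw [hmem e' he'] at hx'
      exact hlt.ne ((mem_leastRotations.mp he).2.eq_of_isRotated (mem_leastRotations.mp he').2
        (hx.trans hx'.symm))
  · exact Multiset.coe_nodup.mpr ((sorted_allWords n).imp fun h => h.ne)

theorem BW_dividingNecklaces [Nontrivial A] {n : ℕ} (hn : 0 < n) :
    BW (dividingNecklaces A hn) =
      wpow (Finset.univ.sort (· ≤ ·)) (Fintype.card A ^ (n - 1)) := by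
  rw [BW, table_dividingNecklaces]
  obtain ⟨m, rfl⟩ := Nat.exists_eq_succ_of_ne_zero hn.ne'
  exact filterMap_getLast?_allWords m

theorem map_lyndon_dividingNecklaces {n : ℕ} (hn : 0 < n) :
    (dividingNecklaces A hn).map Necklace.lyndon = ((leastRotations A n).map root : List _) := by
  rw [dividingNecklaces, Multiset.map_coe, List.map_map]
  conv_rhs => rw [← List.attach_map_subtype_val (leastRotations A n), List.map_map]
  congr 1
  refine List.map_congr_left fun e _ => ?_
  exact (mem_leastRotations.mp e.2).2.lyndon_rootNecklace _

theorem lyndonConcat_dividingNecklaces {n : ℕ} (hn : 0 < n) :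
    lyndonConcat (dividingNecklaces A hn) = ((leastRotations A n).map root).flatten := by
  rw [lyndonConcat]
  congr 1
  refine List.Perm.eq_of_pairwise' (r := (· ≤ ·)) (Multiset.pairwise_sort _ _) ?_ ?_
  · rw [List.pairwise_map]
    refine (sorted_leastRotations n).imp_of_mem ?_
    intro e e' he he' h
    have h1 := mem_leastRotations.mp he
    exact h1.2.root_le_root (ne_nil_of_mem_leastRotations hn he)
      (h1.1.trans (mem_leastRotations.mp he').1.symm) h.le
  · rw [← Multiset.coe_eq_coe, Multiset.sort_eq, map_lyndon_dividingNecklaces]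

theorem length_flatten_map_root [Nontrivial A] {n : ℕ} (hn : 0 < n) :
    ((leastRotations A n).map root).flatten.length = Fintype.card A ^ n := by
  have h := congrArg List.length (table_dividingNecklaces (A := A) hn)
  have h1 := congrArg Multiset.card (coe_table (dividingNecklaces A hn))
  rw [Multiset.coe_card, h, length_allWords, Multiset.card_bind] at h1
  rw [h1, List.length_flatten, ← Multiset.sum_coe, ← Multiset.map_coe,
    ← map_lyndon_dividingNecklaces hn, Multiset.map_map]
  congr 1
  refine Multiset.map_congr rfl fun N hN => ?_
  obtain ⟨e, he, rfl⟩ := (mem_dividingNecklaces hn).mp hN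
  rw [Function.comp_apply, (mem_leastRotations.mp he).2.lyndon_rootNecklace,
    Function.comp_apply, Multiset.card_map, Necklace.card_words, length_rootNecklace]

end AllWords

/-! ### The succession of least rotations -/

section SortedFilter

variable {A : Type*} [LinearOrder A]

theorem eq_of_sorted_of_mem_iff {L L' : List A} (hL : L.Pairwise (· < ·))
    (hL' : L'.Pairwise (· < ·)) (h : ∀ x, x ∈ L ↔ x ∈ L') : L = L' := by
  refine List.Perm.eq_of_pairwise' (r := (· ≤ ·)) (hL.imp fun h => h.le)
    (hL'.imp fun h => h.le) ?_
  exact (List.perm_ext_iff_of_nodup (hL.imp fun h => h.ne) (hL'.imp fun h => h.ne)).mpr h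

theorem filter_lt_append_filter {L : List (List A)} (hL : L.Pairwise (· < ·)) (x : List A)
    (p : List A → Prop) [DecidablePred p] (hp : ∀ y, y < x → p y) :
    L.filter (· < x) ++ L.filter (fun y => x ≤ y ∧ p y) = L.filter fun y => p y := by
  refine eq_of_sorted_of_mem_iff ?_ (hL.filter _) ?_
  · rw [List.pairwise_append]
    refine ⟨hL.filter _, hL.filter _, fun a ha b hb => ?_⟩
    simp only [List.mem_filter, decide_eq_true_eq] at ha hb
    exact ha.2.trans_le hb.2.1
  · intro y
    simp only [List.mem_append, List.mem_filter, decide_eq_true_eq]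
    constructor
    · rintro (⟨h, h1⟩ | ⟨h, -, h1⟩)
      · exact ⟨h, hp y h1⟩
      · exact ⟨h, h1⟩
    · rintro ⟨h, h1⟩
      rcases lt_or_ge y x with h2 | h2
      · exact Or.inl ⟨h, h2⟩
      · exact Or.inr ⟨h, h2, h1⟩

theorem isLeastRotation_of_forall_append {w : List A} (h : ∀ p q, w = p ++ q → w ≤ q ++ p) :
    IsLeastRotation w := by
  intro i
  cases w with
  | nil => simp
  | cons a s =>
    rw [← List.rotate_mod, List.rotate_eq_drop_append_take (Nat.mod_lt _ (by simp)).le]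
    exact h _ _ (List.take_append_drop _ _).symm

theorem isLeastRotation_replicate (n : ℕ) (a : A) : IsLeastRotation (List.replicate n a) := by
  intro i
  rw [List.rotate_replicate]

theorem IsLeastRotation.head_le {a b : A} {s : List A} (h : IsLeastRotation (a :: s))
    (hb : b ∈ a :: s) : a ≤ b := by
  obtain ⟨p, q, hpq⟩ := List.append_of_mem hb
  have h1 := h
  rw [hpq] at h1
  have h2 := h1.append_le
  rw [← hpq, List.cons_append, cons_le_cons_word] at h2
  rcases h2 with h2 | h2
  · exact h2.le
  · exact h2.1.le

end SortedFilter

section RootLetters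

variable {A : Type*}

theorem wpow_singleton (a : A) (n : ℕ) : wpow [a] n = List.replicate n a := by
  simp [wpow]

theorem root_replicate (a : A) {n : ℕ} (hn : 0 < n) : root (List.replicate n a) = [a] := by
  rw [← wpow_singleton]
  refine root_wpow ⟨by simp, fun u t h => ?_⟩ hn
  have h1 := congrArg List.length h
  rw [length_wpow, List.length_singleton] at h1
  rw [Nat.eq_one_of_mul_eq_one_right h1, wpow_one] at h
  exact h

theorem mem_root_of_mem {e : List A} (he : e ≠ []) {a : A} (ha : a ∈ e) : a ∈ root e := by
  obtain ⟨t, -, ht⟩ := exists_wpow_root he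
  rw [← ht, wpow, List.mem_flatten] at ha
  obtain ⟨l, hl, ha⟩ := ha
  rwa [List.eq_of_mem_replicate hl] at ha

end RootLetters

section Top

variable {A : Type*} [LinearOrder A] [OrderTop A]

theorem le_replicate_top (w : List A) : w ≤ List.replicate w.length ⊤ := by
  induction w with
  | nil => exact le_rfl
  | cons a w ih =>
    rw [List.length_cons, List.replicate_succ, cons_le_cons_word]
    rcases (le_top : a ≤ ⊤).lt_or_eq with h | h
    · exact Or.inl h
    · exact Or.inr ⟨h, ih⟩

/-- Raising a letter of a least rotation and filling up with `⊤` after it gives a least rotation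
again. -/
theorem IsLeastRotation.append_cons_replicate_top {u v : List A} {c d : A} (hc : c < d)
    (h : IsLeastRotation (u ++ c :: v)) :
    IsLeastRotation (u ++ d :: List.replicate v.length ⊤) := by
  refine isLeastRotation_of_forall_append fun p q hpq => ?_
  rcases List.append_eq_append_iff.mp hpq with ⟨b, rfl, hb⟩ | ⟨q', rfl, rfl⟩
  · -- The cut lies behind `u`, so that the rotation begins with `d` or with `⊤`.
    rcases q with _ | ⟨a, q⟩
    · simp [hb]
    have ha : d ≤ a ∧ (b = [] ∨ a = ⊤) := by
      rcases b with _ | ⟨b₀, b⟩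
      · rw [List.nil_append, List.cons.injEq] at hb
        exact ⟨hb.1.le, Or.inl rfl⟩
      · rw [List.cons_append, List.cons.injEq] at hb
        have : a = ⊤ := List.eq_of_mem_replicate (n := v.length) (by rw [hb.2]; simp)
        exact ⟨this ▸ le_top, Or.inr this⟩
    rcases u with _ | ⟨a₀, u⟩
    · rw [List.nil_append, List.nil_append, List.cons_append, cons_le_cons_word]
      rcases ha.1.lt_or_eq with h1 | rfl
      · exact Or.inl h1
      refine Or.inr ⟨rfl, ?_⟩
      have hl := congrArg List.length hb
      simp only [List.length_cons, List.length_replicate, List.length_append] at hl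
      rcases ha.2 with rfl | rfl
      · rw [List.nil_append, List.cons.injEq] at hb
        rw [hb.2, List.append_nil]
      · -- All letters are `⊤` here.
        have h1 : ∀ x ∈ b ++ ⊤ :: q, x = ⊤ := by
          rw [← hb, ← List.replicate_succ]
          exact fun x hx => List.eq_of_mem_replicate hx
        have h2 : q ++ b = List.replicate v.length ⊤ := by
          refine List.eq_replicate_iff.mpr ⟨by rw [List.length_append]; omega, fun x hx => ?_⟩
          refine h1 x ?_
          rcases List.mem_append.mp hx with hx | hx <;> simp [hx]
        rw [h2]
    · have h1 : a₀ ≤ c := h.head_le (by simp)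
      rw [List.cons_append, List.cons_append, cons_le_cons_word]
      exact Or.inl (h1.trans_lt (hc.trans_le ha.1))
  · -- The cut lies in `u`.
    rcases p with _ | ⟨a, p⟩
    · simp
    rw [List.append_assoc, List.append_assoc]
    rw [List.append_assoc] at h
    have h1 := h.append_le
    -- Compare the first `|q'|` letters; where they agree, the next letters differ.
    obtain ⟨x, y, hxy, hx⟩ : ∃ x y, (a :: p) ++ q' = x ++ y ∧ x.length = q'.length :=
      ⟨_, _, (List.take_append_drop q'.length _).symm, by simp; omega⟩
    have hy : y.length = p.length + 1 := by
      have := congrArg List.length hxy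
      simp at this
      omega
    rw [← List.append_assoc, hxy] at h1 ⊢
    rw [List.append_assoc] at h1 ⊢
    rw [List.append_assoc] at h1
    rcases (le_of_append_le_append hx h1).lt_or_eq with h2 | rfl
    · exact (append_lt_append_of_lt hx h2 _ _).le
    · rw [append_le_append_left_iff] at h1 ⊢
      rcases y with _ | ⟨b, y⟩
      · simp at hy
      rw [List.cons_append, List.cons_append, cons_le_cons_word] at h1
      rw [List.cons_append, List.cons_append, cons_le_cons_word]
      refine Or.inl (lt_of_le_of_lt ?_ hc)
      rcases h1 with h1 | h1
      · exact h1.le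
      · exact h1.1.le

/-- If `u v` is a least rotation and `v` is not a power of the letter `⊤`, then some larger least
rotation of the same length begins with `u`. -/
theorem IsLeastRotation.exists_gt {u v : List A} (h : IsLeastRotation (u ++ v))
    (hv : ∃ a ∈ v, a ≠ ⊤) :
    ∃ x, IsLeastRotation x ∧ x.length = (u ++ v).length ∧ u ++ v < x ∧ u <+: x := by
  obtain ⟨c, hcv, hc⟩ := hv
  obtain ⟨v₁, v₂, rfl⟩ := List.append_of_mem hcv
  rw [← List.append_assoc] at h
  refine ⟨_, h.append_cons_replicate_top hc.lt_top, by simp, ?_, ?_⟩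
  · rw [List.append_assoc, append_lt_append_left_iff, append_lt_append_left_iff,
      List.cons_lt_cons_iff]
    exact Or.inl hc.lt_top
  · rw [List.append_assoc]
    exact List.prefix_append _ _

/-- The words `u ≤ [⊤]` are those that do not begin with `⊤`, and the word `[⊤]` itself. -/
theorem le_singleton_top_of_append {u v : List A} (h : IsLeastRotation (u ++ v))
    (hne : ∃ a ∈ u ++ v, a ≠ ⊤) : u ≤ [⊤] := by
  rcases u with _ | ⟨a, u⟩
  · exact nil_le_word _
  rw [cons_le_cons_word]
  left
  by_contra hc
  obtain rfl : a = ⊤ := not_lt_top_iff.mp hc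
  obtain ⟨b, hb, hb'⟩ := hne
  exact hb' (top_le_iff.mp (h.head_le hb))

theorem prefix_singleton_top {u : List A} {n : ℕ} (hu : u ≤ [⊤])
    (h : u <+: List.replicate n ⊤) : u <+: [⊤] := by
  rcases u with _ | ⟨a, u⟩
  · exact List.nil_prefix
  have ha : a = ⊤ := List.eq_of_mem_replicate (h.subset (by simp))
  subst ha
  rw [cons_le_cons_word] at hu
  rcases hu with hu | ⟨-, hu⟩
  · exact absurd hu (lt_irrefl _)
  · rw [le_antisymm hu (nil_le_word _)]

theorem exists_ne_top_of_ne {n : ℕ} {e : List A} (he : e.length = n)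
    (h : e ≠ List.replicate n ⊤) : ∃ a ∈ e, a ≠ ⊤ := by
  by_contra hc
  push Not at hc
  exact h (List.eq_replicate_iff.mpr ⟨he, hc⟩)

end Top

/-! ### Splitting the concatenation of Lyndon words -/

section Concat

variable {A : Type*} [LinearOrder A] [OrderTop A] [Fintype A]

variable (A) in
/-- The concatenation of the Lyndon words of length dividing `n`, in ascending order. -/
noncomputable def rootConcat (n : ℕ) : List A := ((leastRotations A n).map root).flatten

/-- The part of `rootConcat A n` coming from the least rotations below `x`. -/
noncomputable def below (n : ℕ) (x : List A) : List A :=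
  (((leastRotations A n).filter (· < x)).map root).flatten

/-- The part of `rootConcat A n` coming from the least rotations not below `x`. -/
noncomputable def above (n : ℕ) (x : List A) : List A :=
  (((leastRotations A n).filter (x ≤ ·)).map root).flatten

omit [OrderTop A] in
theorem below_append_above (n : ℕ) (x : List A) : below n x ++ above n x = rootConcat A n := by
  have h := filter_lt_append_filter (sorted_leastRotations (A := A) n) x (fun _ => True)
    fun _ _ => trivial
  rw [below, above, rootConcat, ← List.flatten_append, ← List.map_append]
  simp only [and_true] at h
  rw [h]
  simp

omit [OrderTop A] in
theorem below_prefix_below (n : ℕ) {x y : List A} (h : x ≤ y) : below n x <+: below n y := by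
  have h := filter_lt_append_filter (sorted_leastRotations (A := A) n) x (· < y)
    fun _ hz => hz.trans_le h
  rw [below, below, ← h, List.map_append, List.flatten_append]
  exact List.prefix_append _ _

omit [OrderTop A] in
theorem length_below_mono (n : ℕ) {x y : List A} (h : x ≤ y) :
    (below n x).length ≤ (below n y).length :=
  (below_prefix_below n h).length_le

omit [OrderTop A] in
theorem below_eq_append_root {n : ℕ} {e x : List A} (he : e ∈ leastRotations A n) (hex : e < x)
    (hmax : ∀ e' ∈ leastRotations A n, e' < x → e' ≤ e) : below n x = below n e ++ root e := by
  have h := filter_lt_append_filter (sorted_leastRotations (A := A) n) e (· < x)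
    fun _ hz => hz.trans hex
  have h1 : (leastRotations A n).filter (fun y => e ≤ y ∧ y < x) = [e] := by
    refine eq_of_sorted_of_mem_iff ((sorted_leastRotations n).filter _) (by simp) fun y => ?_
    simp only [List.mem_filter, decide_eq_true_eq, List.mem_singleton]
    constructor
    · rintro ⟨h1, h2, h3⟩
      exact le_antisymm (hmax y h1 h3) h2
    · rintro rfl
      exact ⟨he, le_rfl, hex⟩
  rw [h1] at h
  rw [below, below, ← h, List.map_append, List.flatten_append]
  simp

omit [OrderTop A] in
/-- The part up to and including the root of `e`: as all words have the same length, `e' ≤ e` is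
the same as `e' < e ++ [b]`. -/
theorem below_append_singleton {n : ℕ} {e : List A} (he : e ∈ leastRotations A n) (b : A) :
    below n (e ++ [b]) = below n e ++ root e := by
  have h : ∀ e' ∈ leastRotations A n, e' < e ++ [b] ↔ e' ≤ e := fun e' he' =>
    lt_append_singleton_iff
      ((mem_leastRotations.mp he').1.trans (mem_leastRotations.mp he).1.symm) b
  exact below_eq_append_root he ((h e he).mpr le_rfl) fun e' he' h' => (h e' he').mp h'

theorem replicate_top_mem_leastRotations (n : ℕ) :
    List.replicate n ⊤ ∈ leastRotations A n :=
  mem_leastRotations.mpr ⟨List.length_replicate, isLeastRotation_replicate n ⊤⟩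

theorem le_replicate_top_of_mem {n : ℕ} {e : List A} (he : e ∈ leastRotations A n) :
    e ≤ List.replicate n ⊤ := by
  conv_rhs => rw [← (mem_leastRotations.mp he).1]
  exact le_replicate_top e

/-- The concatenation of the Lyndon words from the root of `e` on begins not only with this root
but with all of `e`: the next least rotation still begins with the part of `e` before its last
root. -/
theorem prefix_flatten_map_root {n : ℕ} (hn : 0 < n) (e : List A) (L : List (List A))
    (hL : (e :: L).Pairwise (· < ·)) (hS : ∀ y ∈ e :: L, y ∈ leastRotations A n)
    (hup : ∀ x ∈ leastRotations A n, e ≤ x → x ∈ e :: L) (he : e ≠ List.replicate n ⊤) :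
    e <+: ((e :: L).map root).flatten := by
  induction L generalizing e with
  | nil =>
    have h := hup _ (replicate_top_mem_leastRotations n) (le_replicate_top_of_mem (hS e (by simp)))
    exact absurd (List.mem_singleton.mp h).symm he
  | cons e' L ih =>
    have heS := hS e (by simp)
    have hel := (mem_leastRotations.mp heS).1
    have hne := ne_nil_of_mem_leastRotations hn heS
    have hee' : e < e' := List.rel_of_pairwise_cons hL (by simp)
    obtain ⟨u, hu⟩ := root_suffix hne
    have hlr := (mem_leastRotations.mp heS).2
    rw [← hu] at hlr
    have htop : ∃ a ∈ root e, a ≠ ⊤ := by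
      obtain ⟨a, ha, ha'⟩ := exists_ne_top_of_ne hel he
      exact ⟨a, mem_root_of_mem hne ha, ha'⟩
    obtain ⟨x, hx, hxl, hex, hux⟩ := hlr.exists_gt htop
    rw [hu] at hxl hex
    have hx' : x ∈ e' :: L := by
      have h := hup x (mem_leastRotations.mpr ⟨hxl.trans hel, hx⟩) hex.le
      exact (List.mem_cons.mp h).resolve_left hex.ne'
    have hex' : e' ≤ x := by
      rcases List.mem_cons.mp hx' with rfl | h
      · exact le_rfl
      · exact (List.rel_of_pairwise_cons hL.of_cons h).le
    have hue : u <+: e' := by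
      obtain ⟨y, rfl⟩ := hux
      refine prefix_of_le_of_le (le_trans ?_ hee'.le) hex'
      exact le_of_prefix ⟨_, hu⟩
    have hroot : root e ++ u = e := by
      obtain ⟨t, ht0, ht⟩ := exists_wpow_root hne
      obtain ⟨t, rfl⟩ := Nat.exists_eq_succ_of_ne_zero ht0.ne'
      have h1 : u = wpow (root e) t := by
        rw [Nat.succ_eq_add_one, wpow_succ'] at ht
        conv_rhs at hu => rw [← ht]
        exact List.append_cancel_right hu
      conv_rhs => rw [← ht, Nat.succ_eq_add_one, wpow_succ, ← h1]
    rw [List.map_cons, List.flatten_cons]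
    conv_lhs => rw [← hroot]
    rw [List.prefix_append_right_inj]
    by_cases he' : e' = List.replicate n ⊤
    · -- Here `u` is empty, as no letter `⊤` can begin `e`.
      have hu0 : u = [] := by
        rcases u with _ | ⟨a, u⟩
        · rfl
        have ha : a = ⊤ := by
          rw [he'] at hue
          exact List.eq_of_mem_replicate (hue.subset (by simp))
        subst ha
        obtain ⟨b, hb, hb'⟩ := htop
        exact absurd (top_le_iff.mp (IsLeastRotation.head_le hlr (by simp [hb]))) hb'
      rw [hu0]
      exact List.nil_prefix
    · refine hue.trans (ih e' hL.of_cons (fun y hy => hS y (List.mem_cons_of_mem _ hy)) ?_ he')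
      intro y hy hy'
      exact (List.mem_cons.mp (hup y hy (hee'.le.trans hy'))).resolve_left
        (hee'.trans_le hy').ne'

/-- A word `u` begins the part `above n x` if the least rotations from `x` on start with one that
has the prefix `u`. The condition `u ≤ [⊤]` is needed because the root of `⊤ ⋯ ⊤` is the single
letter `⊤`, with which the concatenation ends. -/
theorem prefix_above {n : ℕ} (hn : 0 < n) {x u e : List A} (hux : u ≤ x)
    (he : e ∈ leastRotations A n) (hxe : x ≤ e) (hue : u <+: e) (hu : u ≤ [⊤]) :
    u <+: above n x := by
  have hmem : ∀ y, y ∈ (leastRotations A n).filter (x ≤ ·) ↔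
      y ∈ leastRotations A n ∧ x ≤ y := by simp
  have hsort := (sorted_leastRotations (A := A) n).filter (x ≤ ·)
  rw [above]
  generalize hL : (leastRotations A n).filter (x ≤ ·) = L at hmem hsort
  rcases L with _ | ⟨e', L⟩
  · exact absurd ((hmem e).mpr ⟨he, hxe⟩) (by simp)
  have h1 := (hmem e').mp (by simp)
  have h2 : e' ≤ e := by
    rcases List.mem_cons.mp ((hmem e).mpr ⟨he, hxe⟩) with rfl | h
    · exact le_rfl
    · exact (List.rel_of_pairwise_cons hsort h).le
  have h3 : u <+: e' := by
    obtain ⟨y, rfl⟩ := hue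
    exact prefix_of_le_of_le (hux.trans h1.2) h2
  by_cases htop : e' = List.replicate n ⊤
  · rw [htop] at h3 ⊢
    rw [List.map_cons, List.flatten_cons, root_replicate _ hn]
    exact (prefix_singleton_top hu h3).trans (List.prefix_append _ _)
  · exact h3.trans (prefix_flatten_map_root hn e' L hsort (fun y hy => ((hmem y).mp hy).1)
      (fun y hy hy' => (hmem y).mpr ⟨hy, h1.2.trans hy'⟩) htop)

/-- The last least rotation below a prefix `u` of a least rotation ends in a run of `⊤` that fills
up the positions beyond the length of `u`, and so does its root. -/
theorem exists_last_below {n : ℕ} (hn : 0 < n) {u e₀ : List A} (he₀ : e₀ ∈ leastRotations A n)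
    (hu : u <+: e₀) (h : ∃ e ∈ leastRotations A n, e < u) :
    ∃ e ∈ leastRotations A n, e < u ∧ (∀ e' ∈ leastRotations A n, e' < u → e' ≤ e) ∧
      List.replicate (n - u.length) ⊤ <:+ root e := by
  obtain ⟨e, he, hmax⟩ : ∃ e ∈ ((leastRotations A n).filter (· < u)).toFinset,
      ∀ e' ∈ ((leastRotations A n).filter (· < u)).toFinset, e' ≤ e := by
    refine Finset.exists_max_image _ id ?_
    obtain ⟨e, he, heu⟩ := h
    exact ⟨e, by simp [he, heu]⟩
  simp only [List.mem_toFinset, List.mem_filter, decide_eq_true_eq, and_imp] at he hmax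
  obtain ⟨he, heu⟩ := he
  refine ⟨e, he, heu, hmax, ?_⟩
  have hel := mem_leastRotations.mp he
  have hne := ne_nil_of_mem_leastRotations hn he
  have hul : u.length ≤ n := by
    rw [← (mem_leastRotations.mp he₀).1]
    exact hu.length_le
  have hdrop : e.drop u.length = List.replicate (n - u.length) ⊤ := by
    by_contra hc
    have h1 := exists_ne_top_of_ne (by rw [List.length_drop, hel.1]) hc
    have h2 := hel.2
    rw [← List.take_append_drop u.length e] at h2
    obtain ⟨x, hx, hxl, hex, hux⟩ := h2.exists_gt h1
    rw [List.take_append_drop] at hxl hex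
    have h3 : x.take u.length = e.take u.length := by
      have := List.prefix_iff_eq_take.mp hux
      rw [List.length_take, hel.1, min_eq_left hul] at this
      exact this.symm
    have h4 : x < u := lt_of_take_lt_self (by rw [h3]; exact take_lt_of_lt heu)
    exact absurd (hmax x (mem_leastRotations.mpr ⟨hxl.trans hel.1, hx⟩) h4) (not_le.mpr hex)
  have hsuf : List.replicate (n - u.length) ⊤ <:+ e := by
    rw [← hdrop]
    exact List.drop_suffix _ _
  refine List.suffix_of_suffix_length_le hsuf (root_suffix hne) ?_
  by_contra hc
  have h1 := List.suffix_of_suffix_length_le (root_suffix hne) hsuf (not_le.mp hc).le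
  have h2 : e = List.replicate n ⊤ := by
    refine List.eq_replicate_iff.mpr ⟨hel.1, fun b hb => ?_⟩
    exact List.eq_of_mem_replicate (h1.subset (mem_root_of_mem hne hb))
  rw [h2] at heu
  exact absurd ((le_of_prefix hu).trans (le_replicate_top_of_mem he₀)) (not_le.mpr heu)

end Concat

/-! ### Cyclic factors -/

section Windows

variable {A : Type*}

theorem take_rotate_of_prefix_drop {w x : List A} {i : ℕ} (hi : i ≤ w.length)
    (h : x <+: w.drop i) : (w.rotate i).take x.length = x := by
  rw [List.rotate_eq_drop_append_take hi, List.take_append_of_le_length h.length_le]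
  exact (List.prefix_iff_eq_take.mp h).symm

theorem add_length_le_of_prefix_drop {w x : List A} {i : ℕ} (hx : 0 < x.length)
    (h : x <+: w.drop i) : i + x.length ≤ w.length := by
  have := h.length_le
  rw [List.length_drop] at this
  omega

theorem take_rotate_succ {w y : List A} {a : A} {i n : ℕ} (hn : n ≤ w.length)
    (h : (w.rotate i).take n = a :: y) : ∃ b, (w.rotate (i + 1)).take n = y ++ [b] := by
  have hl := congrArg List.length h
  rw [List.length_take, List.length_rotate, min_eq_left hn, List.length_cons] at hl
  subst hl
  rcases hv : w.rotate i with _ | ⟨a', v⟩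
  · rw [hv] at h
    simp at h
  have hvl : v.length + 1 = w.length := by
    rw [← List.length_rotate w i, hv, List.length_cons]
  rw [hv, List.take_succ_cons, List.cons.injEq] at h
  have h1 : w.rotate (i + 1) = v ++ [a'] := by
    rw [← List.rotate_rotate, hv, List.rotate_cons_succ, List.rotate_zero]
  have h2 : y <+: (w.rotate (i + 1)).take (y.length + 1) := by
    rw [h1]
    refine List.prefix_take_iff.mpr ⟨?_, Nat.le_succ _⟩
    rw [← h.2]
    exact (List.take_prefix _ _).trans (List.prefix_append _ _)
  obtain ⟨r, hr⟩ := h2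
  have h3 := congrArg List.length hr
  rw [List.length_append, List.length_take, List.length_rotate, min_eq_left hn] at h3
  obtain ⟨b, rfl⟩ := List.length_eq_one_iff.mp (by omega : r.length = 1)
  exact ⟨b, hr.symm⟩

/-- A rotation other than the trivial one moves a suffix no longer than the primitive root to the
front, since rotating by the length of the root changes nothing. -/
theorem exists_rotate_eq_of_isRotated {e w : List A} (he : e ≠ []) (h : e ~r w) (hne : w ≠ e) :
    ∃ u v, u ++ v = e ∧ v ++ u = w ∧ u ≠ [] ∧ v ≠ [] ∧ v.length ≤ (root e).length := by
  obtain ⟨i, rfl⟩ := h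
  have hd := length_root_pos he
  obtain ⟨m, hm⟩ := length_root_dvd he
  have hmod := Nat.mod_lt i hd
  have hper : ∀ i c, e.rotate (i + (root e).length * c) = e.rotate i := by
    intro i c
    obtain ⟨t, -, ht⟩ := exists_wpow_root he
    have h1 : e.rotate ((root e).length * c) = e := by
      have h2 := rotate_wpow (root e) t ((root e).length * c)
      rwa [List.rotate_length_mul, ht] at h2
    rw [Nat.add_comm, ← List.rotate_rotate, h1]
  have hrot : e.rotate i = e.rotate (i % (root e).length) := by
    conv_lhs => rw [← Nat.mod_add_div i (root e).length, hper]
  have h0 : i % (root e).length ≠ 0 := by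
    intro h0
    rw [h0, List.rotate_zero] at hrot
    exact hne hrot
  have hle := length_root_le he
  -- Rotate by the representative of `i` among the last `|root e|` positions.
  set r := i % (root e).length + (e.length - (root e).length) with hr
  have hrot' : e.rotate i = e.rotate r := by
    have h1 : e.length - (root e).length = (root e).length * (m - 1) := by
      rw [Nat.mul_sub, ← hm, Nat.mul_one]
    rw [hrot, hr, h1, hper]
  have hrl : r < e.length := by omega
  refine ⟨e.take r, e.drop r, List.take_append_drop _ _, ?_, ?_, ?_, ?_⟩
  · rw [hrot', List.rotate_eq_drop_append_take hrl.le]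
  · rw [← List.length_pos_iff, List.length_take]
    omega
  · rw [← List.length_pos_iff, List.length_drop]
    omega
  · rw [List.length_drop]
    omega

/-- As there are as many positions as words, it suffices that every word can be read. -/
theorem isDeBruijnWord_of_exists [Fintype A] {n : ℕ} {w : List A}
    (hl : w.length = Fintype.card A ^ n) (hn : n ≤ w.length)
    (h : ∀ u : List A, u.length = n → ∃ i < w.length, (w.rotate i).take n = u) :
    IsDeBruijnWord n w := by
  refine ⟨hl, fun u hu => ?_⟩
  obtain ⟨i, hi, hiu⟩ := h u hu
  refine ⟨i, ⟨hi, hiu⟩, fun j ⟨hj, hju⟩ => ?_⟩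
  let f : Fin w.length → List.Vector A n := fun i =>
    ⟨(w.rotate i).take n, by rw [List.length_take, List.length_rotate, min_eq_left hn]⟩
  have hf : Function.Bijective f := by
    rw [Fintype.bijective_iff_surjective_and_card]
    refine ⟨fun u => ?_, by rw [Fintype.card_fin, card_vector, hl]⟩
    obtain ⟨i, hi, hiu⟩ := h u.1 u.2
    exact ⟨⟨i, hi⟩, Subtype.ext hiu⟩
  have : f ⟨j, hj⟩ = f ⟨i, hi⟩ := Subtype.ext (hju.trans hiu.symm)
  exact congrArg Fin.val (hf.1 this)

theorem exists_first_difference [LinearOrder A] {w w' : List A} (hl : w.length = w'.length)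
    (h : w < w') : ∃ p a c x y, w = p ++ a :: x ∧ w' = p ++ c :: y ∧ a < c := by
  induction w generalizing w' with
  | nil =>
    rw [List.length_eq_zero_iff.mp hl.symm] at h
    exact absurd h (lt_irrefl _)
  | cons a w ih =>
    rcases w' with _ | ⟨c, w'⟩
    · simp at hl
    rw [List.cons_lt_cons_iff] at h
    rcases h with h | ⟨rfl, h⟩
    · exact ⟨[], a, c, w, w', rfl, rfl, h⟩
    · obtain ⟨p, a', c', x, y, rfl, rfl, h1⟩ := ih (by simpa using hl) h
      exact ⟨a :: p, a', c', x, y, rfl, rfl, h1⟩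

theorem replicate_bot_le [LinearOrder A] [OrderBot A] {n : ℕ} {w : List A}
    (h : n ≤ w.length) : List.replicate n ⊥ ≤ w := by
  induction n generalizing w with
  | zero => exact nil_le_word _
  | succ n ih =>
    rcases w with _ | ⟨a, w⟩
    · simp at h
    rw [List.replicate_succ, cons_le_cons_word]
    rcases (bot_le : ⊥ ≤ a).lt_or_eq with h1 | h1
    · exact Or.inl h1
    · exact Or.inr ⟨h1, ih (by simpa using h)⟩

end Windows

/-! ### The positions of the words of length `n` -/

section Positions

variable {A : Type*} [LinearOrder A] [BoundedOrder A] [Fintype A]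

variable (A) in
/-- The concatenation of Lyndon words, preceded by `n - 1` letters `⊤`. As it also ends in these
letters, each word of length `n` that can be read cyclically in the concatenation can be read
linearly here. -/
noncomputable def paddedConcat (n : ℕ) : List A := List.replicate (n - 1) ⊤ ++ rootConcat A n

/-- The position `s` at which a word of length `n` can be read in `paddedConcat A n`, in terms of
the least of its rotations. Either the word itself is least; or it is the rotation `v u` of the
least word `u v`, where `v` is short and is not a power of `⊤`, and is found with the cut between
`v` and `u` just after the root of `u v`; or `v` is a power of `⊤`, and the cut is just before
the first root of a word beginning with `u`. -/
inductive IsPosition (n : ℕ) : List A → ℕ → Prop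
  | least {e : List A} {s : ℕ} (he : e ∈ leastRotations A n) (htop : e ≤ [⊤])
      (hs : s = n - 1 + (below n e).length) : IsPosition n e s
  | cut {u v : List A} {s : ℕ} (h : u ++ v ∈ leastRotations A n) (hv : ∃ a ∈ v, a ≠ ⊤)
      (hl : v.length ≤ (root (u ++ v)).length)
      (hs : s + v.length = n - 1 + (below n (u ++ v ++ [⊥])).length) : IsPosition n (v ++ u) s
  | top {u : List A} {j s : ℕ} (h : u ++ List.replicate j ⊤ ∈ leastRotations A n) (hj : 0 < j)
      (hu : u ≠ []) (htop : u ≤ [⊤]) (hs : s + j = n - 1 + (below n u).length) :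
      IsPosition n (List.replicate j ⊤ ++ u) s

theorem exists_isPosition {n : ℕ} (hn : 0 < n) {w : List A} (hw : w.length = n) :
    ∃ s, IsPosition n w s := by
  by_cases hS : w ∈ leastRotations A n
  · by_cases htop : w ≤ [⊤]
    · exact ⟨_, .least hS htop rfl⟩
    · -- Only powers of `⊤` other than `⊤` itself are left.
      have hwt : w = List.replicate n ⊤ := by
        by_contra hc
        have h1 := (mem_leastRotations.mp hS).2
        obtain ⟨a, ha, ha'⟩ := exists_ne_top_of_ne hw hc
        rw [← List.append_nil w] at h1
        exact htop (le_singleton_top_of_append h1 ⟨a, by simp [ha], ha'⟩)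
      obtain ⟨m, rfl⟩ := Nat.exists_eq_succ_of_ne_zero hn.ne'
      rcases Nat.eq_zero_or_pos m with rfl | hm
      · exact absurd (by rw [hwt]; exact le_rfl) htop
      refine ⟨(below (m + 1) [(⊤ : A)]).length, ?_⟩
      rw [hwt, List.replicate_succ']
      refine .top ?_ hm (by simp) le_rfl (by simp; omega)
      exact replicate_top_mem_leastRotations (m + 1)
  · obtain ⟨e, he, hr⟩ := exists_mem_leastRotations_isRotated w
    rw [hw] at he
    have hne := ne_nil_of_mem_leastRotations hn he
    obtain ⟨u, v, rfl, rfl, hu, hv, hl⟩ := exists_rotate_eq_of_isRotated hne hr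
      (fun h => hS (h ▸ he))
    by_cases hv' : ∃ a ∈ v, a ≠ ⊤
    · refine ⟨n - 1 + (below n (u ++ v ++ [⊥])).length - v.length, .cut he hv' hl ?_⟩
      rw [below_append_singleton he, List.length_append]
      omega
    · push Not at hv'
      have hvr : v = List.replicate v.length ⊤ := List.eq_replicate_iff.mpr ⟨rfl, hv'⟩
      have hvl := List.length_pos_iff.mpr hv
      have hul := List.length_pos_iff.mpr hu
      rw [List.length_append] at hw
      refine ⟨n - 1 + (below n u).length - v.length, ?_⟩
      have hne' : ∃ a ∈ u ++ v, a ≠ ⊤ := by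
        by_contra hc
        push Not at hc
        apply hS
        refine mem_leastRotations.mpr ⟨by rw [List.length_append, hw], ?_⟩
        have : v ++ u = List.replicate (v ++ u).length ⊤ :=
          List.eq_replicate_iff.mpr ⟨rfl, fun a ha => hc a (by simpa [or_comm] using ha)⟩
        rw [this]
        exact isLeastRotation_replicate _ _
      have htop := le_singleton_top_of_append (mem_leastRotations.mp he).2 hne'
      rw [hvr] at he ⊢
      have := IsPosition.top (s := n - 1 + (below n u).length - v.length) he hvl hu htop (by omega)
      rwa [List.length_replicate]

theorem replicate_top_suffix_padded {n : ℕ} (hn : 0 < n) {u e : List A}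
    (he : e ∈ leastRotations A n) (hu : u ≠ []) (hue : u <+: e) :
    List.replicate (n - u.length) ⊤ <:+ List.replicate (n - 1) ⊤ ++ below n u := by
  have hul := List.length_pos_iff.mpr hu
  by_cases h : ∃ e ∈ leastRotations A n, e < u
  · obtain ⟨e', he', hlt, hmax, hsuf⟩ := exists_last_below hn he hue h
    rw [below_eq_append_root he' hlt hmax, ← List.append_assoc]
    exact hsuf.trans (List.suffix_append _ _)
  · have h0 : below n u = [] := by
      rw [below, List.filter_eq_nil_iff.mpr]
      · rfl
      · intro e he
        simpa using fun h1 => h ⟨e, he, h1⟩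
    rw [h0, List.append_nil]
    refine ⟨List.replicate (u.length - 1) ⊤, ?_⟩
    have := hue.length_le
    rw [(mem_leastRotations.mp he).1] at this
    rw [List.replicate_append_replicate]
    congr 1
    omega

theorem IsPosition.prefix_drop {n : ℕ} (hn : 0 < n) {w : List A} {s : ℕ}
    (h : IsPosition n w s) : w <+: (paddedConcat A n).drop s := by
  cases h with
  | least he htop hs =>
    rw [paddedConcat, ← below_append_above n w, ← List.append_assoc, hs, List.drop_left' (by simp)]
    exact prefix_above hn le_rfl he le_rfl (List.prefix_refl _) htop
  | @cut u v _ h hv hl hs =>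
    have hne := ne_nil_of_mem_leastRotations hn h
    have hvs : v <:+ root (u ++ v) :=
      List.suffix_of_suffix_length_le (List.suffix_append _ _) (root_suffix hne) hl
    obtain ⟨r, hr⟩ := hvs
    rw [below_append_singleton h, List.length_append, ← congrArg List.length hr,
      List.length_append] at hs
    rw [paddedConcat, ← below_append_above n (u ++ v ++ [⊥]), below_append_singleton h, ← hr]
    have h1 : List.replicate (n - 1) ⊤ ++ (below n (u ++ v) ++ (r ++ v) ++ above n (u ++ v ++ [⊥]))
        = (List.replicate (n - 1) ⊤ ++ below n (u ++ v) ++ r) ++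
          (v ++ above n (u ++ v ++ [⊥])) := by
      simp
    rw [h1, List.drop_left' (by simp; omega), List.prefix_append_right_inj]
    have h2 := mem_leastRotations.mp h
    obtain ⟨x, hx, hxl, hlt, hux⟩ := h2.2.exists_gt hv
    have hxS : x ∈ leastRotations A n := mem_leastRotations.mpr ⟨hxl.trans h2.1, hx⟩
    refine prefix_above hn ?_ hxS ?_ hux ?_
    · rw [List.append_assoc]
      exact le_of_prefix (List.prefix_append _ _)
    · rw [← not_lt, lt_append_singleton_iff hxl, not_le]
      exact hlt
    · obtain ⟨a, ha, ha'⟩ := hv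
      exact le_singleton_top_of_append h2.2 ⟨a, by simp [ha], ha'⟩
  | @top u j _ h hj hu htop hs =>
    have hl := (mem_leastRotations.mp h).1
    rw [List.length_append, List.length_replicate] at hl
    obtain ⟨r, hr⟩ := replicate_top_suffix_padded hn h hu (List.prefix_append _ _)
    have hrl := congrArg List.length hr
    rw [List.length_append, List.length_append, List.length_replicate, List.length_replicate] at hrl
    have hj' : n - u.length = j := by omega
    rw [hj'] at hr
    rw [paddedConcat, ← below_append_above n u, ← List.append_assoc, ← hr, List.append_assoc,
      List.drop_left' (by omega), List.prefix_append_right_inj]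
    exact prefix_above hn le_rfl h (le_of_prefix (List.prefix_append _ _))
      (List.prefix_append _ _) htop

theorem IsPosition.length_eq {n : ℕ} {w : List A} {s : ℕ} (h : IsPosition n w s) :
    w.length = n := by
  cases h with
  | least he _ _ => exact (mem_leastRotations.mp he).1
  | cut h _ _ _ =>
    rw [← (mem_leastRotations.mp h).1, List.length_append, List.length_append, Nat.add_comm]
  | top h _ _ _ _ =>
    rw [← (mem_leastRotations.mp h).1, List.length_append, List.length_append, Nat.add_comm]

omit [BoundedOrder A] in
theorem length_below_append_singleton_le {n : ℕ} {e e' : List A} (he : e ∈ leastRotations A n)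
    (he' : e' ∈ leastRotations A n) (h : e < e') (b : A) :
    (below n (e ++ [b])).length ≤ (below n e').length := by
  apply length_below_mono
  rw [← not_lt, lt_append_singleton_iff
    ((mem_leastRotations.mp he').1.trans (mem_leastRotations.mp he).1.symm), not_le]
  exact h

/-- A word can be read before the end of the root of its least rotation. -/
theorem IsPosition.lt_length_below {n : ℕ} (hn : 0 < n) {w : List A} {s : ℕ}
    (h : IsPosition n w s) {e : List A} (he : e ∈ leastRotations A n) (hew : e ~r w) :
    s < n - 1 + (below n (e ++ [⊥])).length := by
  have huniq : ∀ e' ∈ leastRotations A n, e' ~r w → e = e' := fun e' he' h' =>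
    (mem_leastRotations.mp he).2.eq_of_isRotated (mem_leastRotations.mp he').2 (hew.trans h'.symm)
  cases h with
  | least he' _ hs =>
    obtain rfl := huniq _ he' (List.IsRotated.refl _)
    rw [below_append_singleton he, List.length_append, hs]
    have := length_root_pos (ne_nil_of_mem_leastRotations hn he)
    omega
  | cut h hv _ hs =>
    obtain rfl := huniq _ h List.isRotated_append
    obtain ⟨a, ha, -⟩ := hv
    have := List.length_pos_of_mem ha
    omega
  | @top u j _ h hj _ _ hs =>
    obtain rfl := huniq _ h List.isRotated_append
    have h1 : (below n u).length ≤ (below n (u ++ List.replicate j ⊤ ++ [⊥])).length := by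
      apply length_below_mono
      rw [List.append_assoc]
      exact le_of_prefix (List.prefix_append _ _)
    omega

theorem length_below_add_le {n : ℕ} {u e : List A} (he : e ∈ leastRotations A n) (heu : e < u)
    (hmax : ∀ e' ∈ leastRotations A n, e' < u → e' ≤ e)
    (hsuf : List.replicate (n - u.length) ⊤ <:+ root e) :
    (below n e).length + (n - u.length) ≤ (below n u).length := by
  rw [below_eq_append_root he heu hmax, List.length_append]
  have := hsuf.length_le
  rw [List.length_replicate] at this
  omega

/-- The greedy property of the concatenation: of two words that differ in the last letter only,
the smaller one is read first. -/
theorem IsPosition.lt_of_lt {n : ℕ} (hn : 0 < n) {t : List A} {a c : A} (hac : a < c) {s s' : ℕ}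
    (h' : IsPosition n (t ++ [a]) s') (h : IsPosition n (t ++ [c]) s) : s' < s := by
  obtain ⟨e', he', hr'⟩ := exists_mem_leastRotations_isRotated (t ++ [a])
  rw [h'.length_eq] at he'
  have hmin := (mem_leastRotations.mp he').2
  have hbound := h'.lt_length_below hn he' hr'
  have hta : t ++ [a] < t ++ [c] := by
    rw [append_lt_append_left_iff, List.cons_lt_cons_iff]
    exact Or.inl hac
  generalize hw : t ++ [c] = w at h hta
  cases h with
  | least he htop hs =>
    have := length_below_append_singleton_le he' he ((hmin.le_of_isRotated hr').trans_lt hta) ⊥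
    omega
  | @cut u v _ h hv hl hs =>
    have hlt : e' < u ++ v := by
      rcases List.eq_nil_or_concat u with rfl | ⟨u₀, c', rfl⟩
      · rw [List.append_nil] at hta
        exact (hmin.le_of_isRotated hr').trans_lt hta
      · rw [List.concat_eq_append, ← List.append_assoc] at hw
        obtain ⟨rfl, h1⟩ := List.append_inj' hw rfl
        obtain rfl : c = c' := by simpa using h1
        rw [List.append_assoc] at hr'
        have h2 : e' ≤ (u₀ ++ [a]) ++ v :=
          hmin.le_of_isRotated (hr'.trans List.isRotated_append)
        refine h2.trans_lt ?_
        rw [List.concat_eq_append, List.append_assoc, List.append_assoc,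
          append_lt_append_left_iff, List.cons_append, List.cons_append, List.cons_lt_cons_iff]
        exact Or.inl hac
    have h1 := length_below_append_singleton_le he' h hlt ⊥
    rw [below_append_singleton h, List.length_append] at hs
    omega
  | @top u j _ h hj hu htop hs =>
    obtain ⟨u₀, c', rfl⟩ := (List.eq_nil_or_concat u).resolve_left hu
    rw [List.concat_eq_append] at hs htop h hw
    rw [← List.append_assoc] at hw
    obtain ⟨rfl, h1⟩ := List.append_inj' hw rfl
    obtain rfl : c = c' := by simpa using h1
    have hlen := (mem_leastRotations.mp h).1
    rw [List.length_append, List.length_replicate] at hlen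
    have hlt : e' < u₀ ++ [c] := by
      rw [List.append_assoc] at hr'
      have h2 : e' ≤ (u₀ ++ [a]) ++ List.replicate j ⊤ :=
        hmin.le_of_isRotated (hr'.trans List.isRotated_append)
      refine h2.trans_lt ?_
      rw [List.append_assoc, append_lt_append_left_iff, List.cons_append, List.cons_lt_cons_iff]
      exact Or.inl hac
    obtain ⟨e, he, heu, hmax, hsuf⟩ :=
      exists_last_below hn h (List.prefix_append _ _) ⟨e', he', hlt⟩
    have hbelow := length_below_add_le he heu hmax hsuf
    rcases (hmax e' he' hlt).lt_or_eq with h2 | rfl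
    · have := length_below_append_singleton_le he' he h2 ⊥
      omega
    · have hb := below_append_singleton he (⊥ : A)
      rw [← below_eq_append_root he heu hmax] at hb
      generalize hw' : List.replicate j ⊤ ++ u₀ ++ [a] = w' at h' hr'
      cases h' with
      | least he'' htop' hs' =>
        -- A word that begins with `⊤` and is at most `[⊤]` has a single letter.
        obtain ⟨j, rfl⟩ := Nat.exists_eq_succ_of_ne_zero hj.ne'
        rw [← hw', Nat.succ_eq_add_one, List.replicate_succ, List.cons_append, List.cons_append,
          cons_le_cons_word] at htop'
        rcases htop' with h3 | ⟨-, h3⟩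
        · exact absurd h3 (lt_irrefl _)
        · exact absurd (le_antisymm h3 (nil_le_word _)) (by simp)
      | @cut u' v' _ h'' hv' hl' hs' =>
        have hjv : j < v'.length := by
          by_contra hc
          obtain ⟨b, hb1, hb2⟩ := hv'
          have h3 : v' <+: List.replicate j ⊤ := by
            refine List.prefix_of_prefix_length_le (List.prefix_append v' u') ?_ (by simpa using hc)
            rw [← hw', List.append_assoc]
            exact List.prefix_append _ _
          exact hb2 (List.eq_of_mem_replicate (h3.subset hb1))
        have h3 : e' = u' ++ v' := hmin.eq_of_isRotated (mem_leastRotations.mp h'').2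
          (hr'.trans List.isRotated_append)
        rw [← h3, hb] at hs'
        omega
      | @top u' j' _ h'' hj' hu' htop' hs' =>
        have h3 : e' = u' ++ List.replicate j' ⊤ := hmin.eq_of_isRotated
          (mem_leastRotations.mp h'').2 (hr'.trans List.isRotated_append)
        have h4 : (below n u').length ≤ (below n e').length := by
          apply length_below_mono
          rw [h3]
          exact le_of_prefix (List.prefix_append _ _)
        omega

theorem replicate_bot_mem_leastRotations (n : ℕ) : List.replicate n ⊥ ∈ leastRotations A n :=
  mem_leastRotations.mpr ⟨List.length_replicate, isLeastRotation_replicate n ⊥⟩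

/-- The only words read across the beginning of the concatenation are `⊤ ⋯ ⊤ ⊥ ⋯ ⊥`. -/
theorem IsPosition.eq_of_lt {n : ℕ} (hn : 0 < n) {w : List A} {s : ℕ} (h : IsPosition n w s)
    (hs : s < n - 1) : ∃ j m, 0 < j ∧ j + (m + 1) = n ∧
      w = List.replicate j ⊤ ++ List.replicate (m + 1) ⊥ := by
  cases h with
  | least _ _ h => omega
  | cut h _ hl h1 =>
    rw [below_append_singleton h, List.length_append] at h1
    omega
  | @top u j _ h hj hu _ h1 =>
    have hlen := (mem_leastRotations.mp h).1
    rw [List.length_append, List.length_replicate] at hlen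
    have hul := List.length_pos_iff.mpr hu
    refine ⟨j, u.length - 1, hj, by omega, ?_⟩
    rw [Nat.sub_add_cancel hul]
    congr 1
    by_contra hc
    have hlt : List.replicate n ⊥ < u := by
      by_contra hge
      have h2 := take_le_take_of_le (not_lt.mp hge) u.length
      rw [List.take_length, List.take_replicate, min_eq_left (by omega)] at h2
      exact hc (le_antisymm h2 (replicate_bot_le le_rfl))
    obtain ⟨e, he, heu, hmax, hsuf⟩ := exists_last_below hn h (List.prefix_append _ _)
      ⟨_, replicate_bot_mem_leastRotations n, hlt⟩
    have := length_below_add_le he heu hmax hsuf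
    omega

end Positions

/-! ### The least de Bruijn word -/

section Main

variable {A : Type*} [LinearOrder A] [BoundedOrder A] [Fintype A] [Nontrivial A]

omit [BoundedOrder A] in
theorem length_rootConcat {n : ℕ} (hn : 0 < n) :
    (rootConcat A n).length = Fintype.card A ^ n :=
  length_flatten_map_root hn

omit [BoundedOrder A] in
theorem le_length_rootConcat {n : ℕ} (hn : 0 < n) : n ≤ (rootConcat A n).length := by
  rw [length_rootConcat hn]
  exact (Nat.lt_pow_self Fintype.one_lt_card).le

theorem prefix_rootConcat {n : ℕ} (hn : 0 < n) :
    List.replicate n ⊥ <+: rootConcat A n := by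
  have h0 : below n (List.replicate n (⊥ : A)) = [] := by
    rw [below, List.filter_eq_nil_iff.mpr]
    · rfl
    · intro e he
      rw [decide_eq_true_eq, not_lt]
      exact replicate_bot_le (mem_leastRotations.mp he).1.ge
  rw [← below_append_above n (List.replicate n ⊥), h0, List.nil_append]
  refine prefix_above hn le_rfl (replicate_bot_mem_leastRotations n) le_rfl
    (List.prefix_refl _) ?_
  obtain ⟨m, rfl⟩ := Nat.exists_eq_succ_of_ne_zero hn.ne'
  rw [Nat.succ_eq_add_one, List.replicate_succ, cons_le_cons_word]
  exact Or.inl bot_lt_top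

/-- The concatenation ends in the root of the last least rotation below the word `⊤`, which ends in
`n - 1` letters `⊤`, followed by the Lyndon word `⊤`. -/
theorem suffix_rootConcat {n : ℕ} (hn : 0 < n) :
    List.replicate (n - 1) ⊤ <:+ rootConcat A n := by
  have htop := replicate_top_mem_leastRotations (A := A) n
  have hpre : [⊤] <+: List.replicate n (⊤ : A) := by
    obtain ⟨m, rfl⟩ := Nat.exists_eq_succ_of_ne_zero hn.ne'
    rw [Nat.succ_eq_add_one, List.replicate_succ]
    exact ⟨_, rfl⟩
  have hlt : List.replicate n ⊥ < [(⊤ : A)] := by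
    obtain ⟨m, rfl⟩ := Nat.exists_eq_succ_of_ne_zero hn.ne'
    rw [Nat.succ_eq_add_one, List.replicate_succ, List.cons_lt_cons_iff]
    exact Or.inl bot_lt_top
  obtain ⟨e, he, heu, hmax, hsuf⟩ := exists_last_below hn htop hpre
    ⟨_, replicate_bot_mem_leastRotations n, hlt⟩
  have habove : above n [(⊤ : A)] = [⊤] := by
    have h1 : (leastRotations A n).filter ([⊤] ≤ ·) = [List.replicate n ⊤] := by
      refine eq_of_sorted_of_mem_iff ((sorted_leastRotations n).filter _) (by simp) fun y => ?_
      simp only [List.mem_filter, decide_eq_true_eq, List.mem_singleton]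
      constructor
      · rintro ⟨h1, h2⟩
        by_contra hc
        have h3 := mem_leastRotations.mp h1
        obtain ⟨b, hb, hb'⟩ := exists_ne_top_of_ne h3.1 hc
        obtain ⟨z, hz⟩ := hpre
        obtain ⟨y, rfl⟩ := prefix_of_le_of_le h2 (y := z)
          (by rw [hz]; exact le_replicate_top_of_mem h1)
        exact hb' (top_le_iff.mp (h3.2.head_le hb))
      · rintro rfl
        exact ⟨htop, le_of_prefix hpre⟩
    rw [above, h1, List.map_singleton, root_replicate _ hn]
    rfl
  rw [← below_append_above n [⊤], below_eq_append_root he heu hmax, habove]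
  obtain ⟨r, hr⟩ := hsuf
  rw [← hr, List.length_singleton]
  refine ⟨below n e ++ r ++ [⊤], ?_⟩
  have h2 : [⊤] ++ List.replicate (n - 1) (⊤ : A) = List.replicate (n - 1) ⊤ ++ [⊤] := by
    rw [← List.replicate_succ', List.singleton_append, ← List.replicate_succ]
  rw [List.append_assoc, h2]
  simp

omit [Nontrivial A] in
theorem IsPosition.prefix_drop_rootConcat {n : ℕ} (hn : 0 < n) {w : List A} {s : ℕ}
    (h : IsPosition n w s) (hs : n - 1 ≤ s) : w <+: (rootConcat A n).drop (s - (n - 1)) := by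
  have h1 := h.prefix_drop hn
  rw [paddedConcat, List.drop_append, List.length_replicate,
    List.drop_eq_nil_of_le (by simpa using hs), List.nil_append] at h1
  exact h1

/-- The concatenation of the Lyndon words of length dividing `n` is a de Bruijn word. -/
theorem isDeBruijnWord_rootConcat {n : ℕ} (hn : 0 < n) : IsDeBruijnWord n (rootConcat A n) := by
  have hN := le_length_rootConcat (A := A) hn
  refine isDeBruijnWord_of_exists (length_rootConcat hn) hN fun u hu => ?_
  obtain ⟨s, hs⟩ := exists_isPosition hn hu
  rcases le_or_gt (n - 1) s with hle | hlt
  · have h1 := hs.prefix_drop_rootConcat hn hle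
    have h2 := add_length_le_of_prefix_drop (by omega) h1
    refine ⟨s - (n - 1), by omega, ?_⟩
    have h3 := take_rotate_of_prefix_drop (by omega) h1
    rwa [hu] at h3
  · -- The word begins in the run of `⊤` at the end and continues at the beginning.
    have h1 := hs.prefix_drop hn
    obtain ⟨C, hC⟩ := suffix_rootConcat (A := A) hn
    have hCl := congrArg List.length hC
    rw [List.length_append, List.length_replicate] at hCl
    refine ⟨C.length + s, by omega, ?_⟩
    have h2 : (rootConcat A n).rotate (C.length + s) =
        (List.replicate (n - 1) ⊤).drop s ++ (rootConcat A n).take (C.length + s) := by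
      rw [List.rotate_eq_drop_append_take (by omega)]
      congr 1
      rw [← hC, List.drop_append]
      simp
    rw [paddedConcat, List.drop_append_of_le_length (by simpa using hlt.le)] at h1
    have h3 : u <+: (rootConcat A n).rotate (C.length + s) := by
      refine List.prefix_of_prefix_length_le h1 ?_ (by rw [List.length_rotate, hu]; exact hN)
      rw [h2, List.prefix_append_right_inj]
      exact List.take_prefix _ _
    have h4 := List.prefix_iff_eq_take.mp h3
    rw [hu] at h4
    exact h4.symm

omit [Nontrivial A] in
/-- The word `⊤ ⋯ ⊤ ⊥ ⋯ ⊥ c` is found just before the first root of a word beginning with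
`⊥ ⋯ ⊥ c`. -/
theorem exists_isPosition_replicate {n j m : ℕ} (h : j + (m + 1) = n) {c : A} (hc : ⊥ < c) :
    (List.replicate m ⊥ ++ [c]) ++ List.replicate j ⊤ ∈ leastRotations A n ∧
    ∃ s, IsPosition n (List.replicate j ⊤ ++ (List.replicate m ⊥ ++ [c])) s ∧
      s + j = n - 1 + (below n (List.replicate m ⊥ ++ [c])).length := by
  have hmem : (List.replicate m ⊥ ++ [c]) ++ List.replicate j ⊤ ∈ leastRotations A n := by
    refine mem_leastRotations.mpr ⟨by simp; omega, ?_⟩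
    have h1 := isLeastRotation_replicate (m + (j + 1)) (⊥ : A)
    rw [List.replicate_add, List.replicate_succ] at h1
    have h2 := h1.append_cons_replicate_top hc
    rw [List.length_replicate] at h2
    simpa using h2
  have htop : List.replicate m ⊥ ++ [c] ≤ [⊤] := by
    rcases m with _ | m
    · rw [List.replicate_zero, List.nil_append, cons_le_cons_word]
      rcases (le_top : c ≤ ⊤).lt_or_eq with h1 | h1
      · exact Or.inl h1
      · exact Or.inr ⟨h1, le_rfl⟩
    · rw [List.replicate_succ, List.cons_append, cons_le_cons_word]
      exact Or.inl (hc.trans_le le_top)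
  refine ⟨hmem, ?_⟩
  rcases Nat.eq_zero_or_pos j with rfl | hj
  · refine ⟨_, ?_, rfl⟩
    rw [List.replicate_zero, List.nil_append]
    rw [List.replicate_zero, List.append_nil] at hmem
    exact .least hmem htop rfl
  · have hle : j ≤ n - 1 + (below n (List.replicate m ⊥ ++ [c])).length := by omega
    exact ⟨_, .top hmem hj (by simp) htop (Nat.sub_add_cancel hle), Nat.sub_add_cancel hle⟩

omit [Nontrivial A] in
/-- Of the words `⊤ ⋯ ⊤ ⊥ ⋯ ⊥ c` with a last letter other than `⊥`, those with fewer letters `⊤`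
are read first. -/
theorem replicate_position_le {n j m j' m' : ℕ} (hn : 0 < n) (h : j + (m + 1) = n)
    (h' : j' + (m' + 1) = n) (hj : j' < j) {b c : A} (hb : ⊥ < b) (hc : ⊥ < c) :
    ∃ s s', IsPosition n (List.replicate j ⊤ ++ (List.replicate m ⊥ ++ [c])) s ∧
      IsPosition n (List.replicate j' ⊤ ++ (List.replicate m' ⊥ ++ [b])) s' ∧ s' ≤ s := by
  obtain ⟨hmem, s, hs, hsj⟩ := exists_isPosition_replicate h hc
  obtain ⟨hmem', s', hs', hsj'⟩ := exists_isPosition_replicate h' hb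
  refine ⟨s, s', hs, hs', ?_⟩
  have hlt : (List.replicate m' ⊥ ++ [b]) ++ List.replicate j' ⊤ < List.replicate m ⊥ ++ [c] := by
    obtain ⟨i, rfl⟩ : ∃ i, m' = m + (i + 1) := ⟨m' - m - 1, by omega⟩
    rw [List.replicate_add, List.replicate_succ, List.append_assoc, List.append_assoc,
      append_lt_append_left_iff, List.cons_append, List.cons_lt_cons_iff]
    exact Or.inl hc
  obtain ⟨e, he, heu, hmax, hsuf⟩ := exists_last_below hn hmem (List.prefix_append _ _)
    ⟨_, hmem', hlt⟩
  have h1 := length_below_add_le he heu hmax hsuf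
  have h2 : (below n (List.replicate m' ⊥ ++ [b])).length ≤ (below n e).length :=
    length_below_mono n ((le_of_prefix (List.prefix_append _ _)).trans (hmax _ hmem' hlt))
  rw [List.length_append, List.length_replicate, List.length_singleton] at h1
  omega

/-- The theorem of Fredricksen, Kessler and Maiorana. -/
theorem isLeast_rootConcat {n : ℕ} (hn : 0 < n) :
    IsLeast {w : List A | IsDeBruijnWord n w} (rootConcat A n) := by
  have hDB := isDeBruijnWord_rootConcat (A := A) hn
  refine ⟨hDB, fun w hw => ?_⟩
  by_contra hlt
  rw [not_le] at hlt
  have hwl : w.length = (rootConcat A n).length := hw.1.trans hDB.1.symm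
  have hN := le_length_rootConcat (A := A) hn
  obtain ⟨p, a, c, x, y, hwp, hCp, hac⟩ := exists_first_difference hwl hlt
  have hbc : ⊥ < c := bot_le.trans_lt hac
  have hpl : p.length < (rootConcat A n).length := by
    rw [hCp]
    simp
  -- The concatenation begins with `n` letters `⊥`, so that the difference occurs after them.
  have hp : n ≤ p.length := by
    by_contra hc
    have h1 : p ++ [c] <+: List.replicate n ⊥ := by
      refine List.prefix_of_prefix_length_le (l₃ := rootConcat A n) ?_ (prefix_rootConcat hn) ?_
      · rw [hCp]
        simp
      · simp
        omega
    exact hbc.ne' (List.eq_of_mem_replicate (h1.subset (by simp)))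
  obtain ⟨p₀, t, rfl, ht⟩ : ∃ p₀ t, p = p₀ ++ t ∧ t.length = n - 1 :=
    ⟨_, _, (List.take_append_drop (p.length - (n - 1)) p).symm, by rw [List.length_drop]; omega⟩
  rw [List.length_append] at hp hpl
  have hca : t ++ [c] <+: (rootConcat A n).drop p₀.length := by
    rw [hCp, List.append_assoc, List.drop_left]
    simp
  have hwa : t ++ [a] <+: w.drop p₀.length := by
    rw [hwp, List.append_assoc, List.drop_left]
    simp
  have hread : ∀ {v z : List A} {i : ℕ}, z.length = n → i ≤ v.length → z <+: v.drop i →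
      (v.rotate i).take n = z := by
    intro v z i hz hi h
    rw [← hz]
    exact take_rotate_of_prefix_drop hi h
  have huniq : ∀ {v : List A}, IsDeBruijnWord n v → ∀ {i i' : ℕ}, i < v.length → i' < v.length →
      (v.rotate i).take n = (v.rotate i').take n → i = i' := by
    intro v hv i i' hi hi' h
    have hlen : ((v.rotate i).take n).length = n := by
      rw [List.length_take, List.length_rotate, hv.1, ← length_rootConcat hn]
      exact min_eq_left hN
    exact (hv.2 _ hlen).unique ⟨hi, rfl⟩ ⟨hi', h.symm⟩
  -- Words read in the concatenation before the difference are read in `w` at the same position.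
  have hcommon : ∀ {z : List A} {i : ℕ}, z.length = n → i < p₀.length →
      z <+: (rootConcat A n).drop i → (w.rotate i).take n = z := by
    intro z i hz hi h
    refine hread hz (by omega) ?_
    have h1 : z <+: (p₀ ++ t).drop i := by
      refine List.prefix_of_prefix_length_le h ?_ (by simp; omega)
      rw [hCp, List.drop_append_of_le_length (l₁ := p₀ ++ t) (by simp; omega)]
      exact List.prefix_append _ _
    refine h1.trans ?_
    rw [hwp, List.drop_append_of_le_length (l₁ := p₀ ++ t) (by simp; omega)]
    exact List.prefix_append _ _
  have hnl : ∀ b : A, (t ++ [b]).length = n := fun b => by simp; omega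
  have hca' := hread (hnl c) (by omega) hca
  have hwa' := hread (hnl a) (by omega) hwa
  have hpos : ∀ {s}, IsPosition n (t ++ [c]) s → s = n - 1 + p₀.length := by
    intro s hs
    rcases le_or_gt (n - 1) s with hle | hgt
    · have h1 := hs.prefix_drop_rootConcat hn hle
      have h2 := add_length_le_of_prefix_drop (by rw [hnl]; exact hn) h1
      rw [hnl] at h2
      have h3 := huniq hDB (i := s - (n - 1)) (i' := p₀.length) (by omega) (by omega)
        ((hread (hnl c) (by omega) h1).trans hca'.symm)
      omega
    · obtain ⟨j, m, -, -, h1⟩ := hs.eq_of_lt hn hgt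
      rw [List.replicate_succ', ← List.append_assoc] at h1
      have h2 := (List.append_inj' h1 rfl).2
      rw [List.cons.injEq] at h2
      exact absurd h2.1 hbc.ne'
  obtain ⟨s, hs⟩ := exists_isPosition hn (hnl c)
  obtain ⟨s', hs'⟩ := exists_isPosition hn (hnl a)
  have hss := hs'.lt_of_lt hn hac hs
  rw [hpos hs] at hss
  rcases le_or_gt (n - 1) s' with hle | hgt
  · -- The word `t a` is read in `w` both before the difference and at the difference.
    have h1 := hcommon (hnl a) (by omega) (hs'.prefix_drop_rootConcat hn hle)
    have h2 := huniq hw (i := s' - (n - 1)) (i' := p₀.length) (by omega) (by omega)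
      (h1.trans hwa'.symm)
    omega
  -- Otherwise `t a` is `⊤ ⋯ ⊤ ⊥ ⋯ ⊥`. Since the words `⊤ ⋯ ⊤ ⊥ ⋯ ⊥ b` with fewer letters `⊤`
  -- and with `b` other than `⊥` are used up, only letters `⊥` can follow in `w`, until `⊥ ⋯ ⊥` is
  -- read for a second time.
  obtain ⟨j, m, hj, hjm, hta⟩ := hs'.eq_of_lt hn hgt
  have ht' : t = List.replicate j ⊤ ++ List.replicate m ⊥ := by
    rw [List.replicate_succ', ← List.append_assoc] at hta
    exact (List.append_inj' hta rfl).1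
  have hchain : ∀ i j', j' + i = j → (w.rotate (p₀.length + i)).take n =
      List.replicate j' ⊤ ++ List.replicate (m + 1 + i) ⊥ := by
    intro i
    induction i with
    | zero =>
      rintro j' rfl
      exact hwa'.trans hta
    | succ i ih =>
      intro j' hj'
      have h1 := ih (j' + 1) (by omega)
      rw [List.replicate_succ, List.cons_append] at h1
      obtain ⟨b, hb⟩ := take_rotate_succ (by omega) h1
      rw [← Nat.add_assoc, hb, List.append_assoc, ← Nat.add_assoc]
      rcases (bot_le : ⊥ ≤ b).lt_or_eq with hbb | rfl
      · exfalso
        obtain ⟨s₁, s₂, hs₁, hs₂, hs₂₁⟩ := replicate_position_le (m := m) (m' := m + 1 + i) hn hjm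
          (by omega) (by omega : j' < j) hbb hbc
        rw [← List.append_assoc, ← ht'] at hs₁
        rw [hpos hs₁] at hs₂₁
        have hlen := hs₂.length_eq
        have hle : n - 1 ≤ s₂ := by
          by_contra hlt
          obtain ⟨j₂, m₂, -, -, h2⟩ := hs₂.eq_of_lt hn (not_le.mp hlt)
          rw [List.replicate_succ', ← List.append_assoc, ← List.append_assoc] at h2
          have h3 := (List.append_inj' h2 rfl).2
          rw [List.cons.injEq] at h3
          exact hbb.ne' h3.1
        have hpre := hs₂.prefix_drop_rootConcat hn hle
        rcases Nat.lt_or_ge (s₂ - (n - 1)) p₀.length with h2 | h2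
        · have h3 := hcommon hlen h2 hpre
          have h4 := huniq hw (i := s₂ - (n - 1)) (i' := p₀.length + i + 1) (by omega) (by omega)
            (by rw [h3, hb, List.append_assoc])
          omega
        · -- The two words cannot be equal, as they have different numbers of leading `⊤`.
          have h3 : s₂ - (n - 1) = p₀.length := by omega
          rw [h3] at hpre
          have h4 := (hread hlen (by omega) hpre).symm.trans hca'
          rw [ht', ← hj', List.replicate_add (m := j') (n := i + 1), List.append_assoc,
            List.append_assoc, List.append_cancel_left_eq, Nat.add_right_comm,
            List.replicate_succ, List.replicate_succ, List.cons_append, List.cons_append,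
            List.cons.injEq] at h4
          exact bot_ne_top h4.1
      · rw [← List.replicate_succ']
  have hend := hchain j 0 (by omega)
  have hstart : (w.rotate 0).take n = List.replicate n ⊥ := by
    refine hcommon List.length_replicate (by omega) ?_
    exact prefix_rootConcat hn
  have h1 := huniq hw (i := p₀.length + j) (i' := 0) (by omega) (by omega) (by
    rw [hstart, hend, List.replicate_zero, List.nil_append]
    congr 1
    omega)
  omega

theorem alphaWord_eq_sort (k : ℕ) : alphaWord k = Finset.univ.sort (· ≤ ·) :=
  (Fin.sort_univ k).symm

end Main

end BWT

/-- The first conjunct says that the inverse transform of `α ^ (k ^ (n - 1))` is well defined. -/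
theorem corollary3p11 (k n : ℕ) (hk : 2 ≤ k) (hn : 1 ≤ n) :
    (∃! M : Multiset (BWT.Necklace (Fin k)),
      BWT.BW M = BWT.wpow (BWT.alphaWord k) (k ^ (n - 1))) ∧
    ∀ M : Multiset (BWT.Necklace (Fin k)),
      BWT.BW M = BWT.wpow (BWT.alphaWord k) (k ^ (n - 1)) →
        IsLeast {w : List (Fin k) | BWT.IsDeBruijnWord n w} (BWT.lyndonConcat M) := by
  obtain ⟨m, rfl⟩ := Nat.exists_eq_add_of_le' hk
  have hBW : BWT.BW (BWT.dividingNecklaces (Fin (m + 2)) hn) =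
      BWT.wpow (BWT.alphaWord (m + 2)) ((m + 2) ^ (n - 1)) := by
    rw [BWT.BW_dividingNecklaces, BWT.alphaWord_eq_sort, Fintype.card_fin]
  refine ⟨⟨_, hBW, fun M hM => BWT.BW_injective (hM.trans hBW.symm)⟩, fun M hM => ?_⟩
  rw [BWT.BW_injective (hM.trans hBW.symm), BWT.lyndonConcat_dividingNecklaces]
  exact BWT.isLeast_rootConcat hn
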